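/- Let $f:\mathbb{C}\to\mathbb{C}$ be a transcendental entire function, that is, an entire function that is not a polynomial, and write $f^n$ for its $n$-th iterate. The Fatou set $F(f)$ is the set of points $z\in\mathbb{C}$ having a neighbourhood at every point of which the family of iterates $(f^n)_{n\ge 0}$ is equicontinuous with respect to the spherical metric. The Julia set is $J(f)=\mathbb{C}\setminus F(f)$, and the escaping set is $I(f)=\{z\in\mathbb{C}: f^n(z)\to\infty \text{ as } n\to\infty\}$. A critical value of $f$ is a point $f(z)$ with $f'(z)=0$. A finite asymptotic value of $f$ is a point $w\in\mathbb{C}$ for which one can choose, for every $r>0$, a connected component $U(r)$ of $f^{-1}(B(w,r))$ such that $U(r')\subset U(r)$ whenever $0<r'<r$, and $\bigcap_{r>0}U(r)=\emptyset$. Let $S(f)$ be the closure of the set of all critical values and finite asymptotic values of $f$. The function $f$ belongs to the Eremenko–Lyubich class $\mathcal{B}$ if $S(f)$ is bounded. **Theorem.** If $f\in\mathcal{B}$, then $F(f)\cap I(f)=\emptyset$ and $J(f)=\overline{I(f)}$. -/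

import Mathlib

open Filter Topology Set

namespace TranscendentalDynamics

/-- A transcendental entire function: holomorphic on the whole plane and not a polynomial. -/
structure IsTranscendentalEntire (f : ℂ → ℂ) : Prop where
  entire : Differentiable ℂ f
  not_polynomial : ¬ ∃ p : Polynomial ℂ, ∀ z, f z = p.eval z

/-- The spherical (great-circle) distance between two points of `ℂ`, viewed by stereographic
projection as points of the unit sphere: the chord between them has length
`2 * ‖z - w‖ / (√(1 + ‖z‖ ^ 2) * √(1 + ‖w‖ ^ 2))`, and a chord of length `c` subtends an arc of
length `2 * arcsin (c / 2)`. -/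
noncomputable def sphericalDist (z w : ℂ) : ℝ :=
  2 * Real.arcsin (‖z - w‖ / (√(1 + ‖z‖ ^ 2) * √(1 + ‖w‖ ^ 2)))

/-- The family of iterates of `f` is equicontinuous at `z` for the spherical metric. -/
def IteratesEquicontinuousAt (f : ℂ → ℂ) (z : ℂ) : Prop :=
  ∀ ε > 0, ∃ δ > 0, ∀ w : ℂ, ‖w - z‖ < δ → ∀ n : ℕ, sphericalDist (f^[n] w) (f^[n] z) < ε

/-- The Fatou set: the points in a neighbourhood of which the iterates are equicontinuous. -/
def fatouSet (f : ℂ → ℂ) : Set ℂ :=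
  {z | ∃ U : Set ℂ, IsOpen U ∧ z ∈ U ∧ ∀ u ∈ U, IteratesEquicontinuousAt f u}

/-- The Julia set: the complement of the Fatou set in the plane. -/
def juliaSet (f : ℂ → ℂ) : Set ℂ := (fatouSet f)ᶜ

/-- The escaping set: the points whose iterates tend to infinity. -/
def escapingSet (f : ℂ → ℂ) : Set ℂ :=
  {z | Tendsto (fun n : ℕ => ‖f^[n] z‖) atTop atTop}

/-- The critical values of `f`: the images of the zeros of the derivative. -/
def criticalValues (f : ℂ → ℂ) : Set ℂ := f '' {z | deriv f z = 0}

/-- `C` is a connected component of the set `A`. -/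
def IsComponentOf (C A : Set ℂ) : Prop := ∃ z ∈ A, C = connectedComponentIn A z

/-- The finite asymptotic values of `f`: the points `w` for which one can choose, for every
`r > 0`, a component `U r` of the preimage of the disc `B(w, r)`, decreasing with `r`, such that
the intersection of all the `U r` is empty. -/
def asymptoticValues (f : ℂ → ℂ) : Set ℂ :=
  {w | ∃ U : ℝ → Set ℂ,
    (∀ r, 0 < r → IsComponentOf (U r) (f ⁻¹' Metric.ball w r)) ∧
    (∀ r' r, 0 < r' → r' < r → U r' ⊆ U r) ∧
    ⋂ r ∈ Ioi (0 : ℝ), U r = ∅}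

/-- The set of singular values: the closure of the critical and finite asymptotic values. -/
def singularSet (f : ℂ → ℂ) : Set ℂ := closure (criticalValues f ∪ asymptoticValues f)

/-- The Eremenko–Lyubich class: transcendental entire functions with bounded singular set. -/
def eremenkoLyubichClass : Set (ℂ → ℂ) :=
  {f | IsTranscendentalEntire f ∧ Bornology.IsBounded (singularSet f)}

end TranscendentalDynamics

/-! The proof uses logarithmic coordinates. Choose `R` so that all singular values and `f 0` have
modulus at most `R`. Over the region of modulus greater than `R` paths lift through `f`
(`exists_path_lift`), so there are holomorphic inverse branches `L` on the half-plane Re u > log R,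
with f(exp(L u)) = exp u. Since `f` is not a polynomial, exp ∘ L is injective
(`injOn_inverse_branch`). Hence the image of `L` never contains two points differing by 2πi, and so
contains no disc of radius 7. Bloch's theorem then bounds |L'(u)| by a constant over Re u − log R
(`norm_deriv_branch_le`), and far to the right every branch contracts by a factor 2.

An escaping point is therefore not in the Fatou set. Pulling back a disc of fixed logarithmic size
around a late point of its orbit gives preimages arbitrarily close to the starting point. Such a
disc contains a representative of a point that `f` sends into the disc of radius `R`
(`exists_norm_eq_norm_le`), whereas equicontinuity near an escaping point would keep all nearby
orbits outside that disc from some time on.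

The same contraction shadows a pseudo-orbit whose moduli at least double at each step, so the
escaping set is nonempty. On a disc free of escaping points all iterates omit two distinct escaping
points p and f(p), so Montel's theorem, proved here through Bloch and Schottky, puts the disc in the
Fatou set. This gives J(f) ⊆ closure of I(f). The converse holds because J(f) is closed and contains
I(f). -/

namespace TranscendentalDynamics

/-! ### Path lifting away from the singular values. -/

/-- A radius `R` such that all singular values of the transcendental entire function `f`, and
`f 0`, lie in the closed disc of radius `R` around the origin. -/
structure IsLogarithmicRadius (f : ℂ → ℂ) (R : ℝ) : Prop where
  transcendental : IsTranscendentalEntire f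
  pos : 0 < R
  norm_zero_le : ‖f 0‖ ≤ R
  deriv_ne_zero : ∀ z, R < ‖f z‖ → deriv f z ≠ 0
  not_asymptotic : ∀ w, R < ‖w‖ → w ∉ asymptoticValues f

theorem exists_isLogarithmicRadius {f : ℂ → ℂ} (hf : f ∈ eremenkoLyubichClass) :
    ∃ R, IsLogarithmicRadius f R := by
  obtain ⟨ht, hb⟩ := hf
  obtain ⟨C, hC⟩ := hb.exists_norm_le
  refine ⟨max (max C ‖f 0‖) 1, ht, by positivity, by simp, fun z hz h0 => ?_, fun w hw hwa => ?_⟩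
  · have := hC (f z) (subset_closure (Or.inl ⟨z, h0, rfl⟩))
    have : C ≤ max (max C ‖f 0‖) 1 := by simp
    linarith
  · have := hC w (subset_closure (Or.inr hwa))
    have : C ≤ max (max C ‖f 0‖) 1 := by simp
    linarith

/-- The zeros of f − f(z) are isolated, and a small circle is compact. A connected set whose image
stays closer than `c` to f(z) cannot cross such a circle; this traps lifts and preimage components
near z. -/
theorem IsTranscendentalEntire.exists_sphere_bound {f : ℂ → ℂ} (hf : IsTranscendentalEntire f)
    (z : ℂ) {s : ℝ} (hs : 0 < s) :
    ∃ r, 0 < r ∧ r ≤ s ∧ ∃ c > 0, ∀ w ∈ Metric.sphere z r, c ≤ ‖f w - f z‖ := by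
  have ha : AnalyticOnNhd ℂ f univ := fun x _ => hf.entire.analyticAt x
  have key : ∀ᶠ w in 𝓝[≠] z, f w ≠ f z := by
    rcases (ha z trivial).eventually_eq_or_eventually_ne (g := fun _ => f z) analyticAt_const
      with h | h
    · exfalso
      have := ha.eqOn_of_preconnected_of_eventuallyEq (g := fun _ => f z)
        (fun x _ => analyticAt_const) isPreconnected_univ (mem_univ z) h
      exact hf.not_polynomial ⟨Polynomial.C (f z), fun w => by simpa using this (mem_univ w)⟩
    · exact h
  rw [eventually_nhdsWithin_iff, Metric.eventually_nhds_iff] at key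
  obtain ⟨ε, hε, hk⟩ := key
  have hr : 0 < min s (ε / 2) := by positivity
  refine ⟨min s (ε / 2), hr, min_le_left _ _, ?_⟩
  have hcomp : IsCompact (Metric.sphere z (min s (ε / 2))) := isCompact_sphere _ _
  obtain ⟨x, hx, hmin⟩ := hcomp.exists_isMinOn (NormedSpace.sphere_nonempty.2 hr.le)
    (f := fun w => ‖f w - f z‖) (by have := hf.entire.continuous; fun_prop)
  refine ⟨‖f x - f z‖, ?_, fun w hw => hmin hw⟩
  rw [gt_iff_lt, norm_pos_iff, sub_ne_zero]
  rw [mem_sphere_iff_norm] at hx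
  refine hk ?_ ?_
  · rw [dist_eq_norm, hx]
    exact (min_le_right _ _).trans_lt (by linarith)
  · rintro rfl
    simp at hx
    linarith

theorem IsPreconnected.subset_ball_of_forall_sphere_not_mem {S : Set ℂ} (hS : IsPreconnected S)
    {z x : ℂ} {r : ℝ} (hsph : ∀ w ∈ Metric.sphere z r, w ∉ S) (hx : x ∈ S)
    (hxb : x ∈ Metric.ball z r) : S ⊆ Metric.ball z r := by
  refine hS.subset_left_of_subset_union (u := Metric.ball z r) (v := (Metric.closedBall z r)ᶜ)
    Metric.isOpen_ball
    Metric.isClosed_closedBall.isOpen_compl ?_ ?_ ⟨x, hx, hxb⟩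
  · rw [Set.disjoint_compl_right_iff_subset]
    exact Metric.ball_subset_closedBall
  · intro w hw
    rcases lt_trichotomy (dist w z) r with h | h | h
    · exact Or.inl h
    · exact absurd hw (hsph w h)
    · exact Or.inr (by simpa using h)

namespace IsLogarithmicRadius

variable {f : ℂ → ℂ} {R : ℝ}

theorem isLocalHomeomorph (h : IsLogarithmicRadius f R) :
    IsLocalHomeomorph (fun z : {z : ℂ // R < ‖f z‖} => f z) := by
  have hopen : IsOpen {z : ℂ | R < ‖f z‖} :=
    isOpen_lt continuous_const h.transcendental.entire.continuous.norm
  have h1 : IsLocalHomeomorphOn f {z : ℂ | R < ‖f z‖} := by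
    refine IsLocalHomeomorphOn.mk f _ fun z hz => ?_
    have hs : HasStrictDerivAt f (deriv f z) z :=
      (h.transcendental.entire.analyticAt z).hasStrictDerivAt
    refine ⟨(hs.hasStrictFDerivAt_equiv (h.deriv_ne_zero z hz)).toOpenPartialHomeomorph f,
      (hs.hasStrictFDerivAt_equiv (h.deriv_ne_zero z hz)).mem_toOpenPartialHomeomorph_source, ?_⟩
    intro x _
    rfl
  rw [isLocalHomeomorph_iff_isLocalHomeomorphOn_univ]
  exact h1.comp (hopen.isOpenEmbedding_subtypeVal.isLocalHomeomorph.isLocalHomeomorphOn (s := univ))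
    (fun x _ => x.2)

theorem isSeparatedMap (f : ℂ → ℂ) (R : ℝ) :
    IsSeparatedMap (fun z : {z : ℂ // R < ‖f z‖} => f z) :=
  T2Space.isSeparatedMap _

/-- Uniqueness of lifts for the local homeomorphism that `f` induces over the region of modulus
greater than `R`. -/
theorem eqOn_of_comp_eqOn (h : IsLogarithmicRadius f R) {A : Type*} [TopologicalSpace A]
    {S : Set A} (hS : IsPreconnected S) {g₁ g₂ : A → ℂ} (h₁ : ContinuousOn g₁ S)
    (h₂ : ContinuousOn g₂ S) (he : ∀ x ∈ S, f (g₁ x) = f (g₂ x)) (hR : ∀ x ∈ S, R < ‖f (g₁ x)‖)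
    {a : A} (ha : a ∈ S) (hg : g₁ a = g₂ a) : EqOn g₁ g₂ S := by
  have hS' : PreconnectedSpace S := isPreconnected_iff_preconnectedSpace.1 hS
  let G₁ : S → {z : ℂ // R < ‖f z‖} := fun x => ⟨g₁ x, hR x x.2⟩
  let G₂ : S → {z : ℂ // R < ‖f z‖} := fun x => ⟨g₂ x, he x x.2 ▸ hR x x.2⟩
  have := (isSeparatedMap f R).eq_of_comp_eq h.isLocalHomeomorph.isLocallyInjective (A := S)
    (g₁ := G₁) (g₂ := G₂)
    ((continuousOn_iff_continuous_domRestrict.1 h₁).subtype_mk _)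
    ((continuousOn_iff_continuous_domRestrict.1 h₂).subtype_mk _)
    (funext fun x => he x x.2) ⟨a, ha⟩ (Subtype.ext hg)
  intro x hx
  exact congrArg Subtype.val (congrFun this ⟨x, hx⟩)

/-- A lift of a path on a half-open interval has a limit at the missing endpoint: otherwise it would
tend to infinity, and the endpoint of the path would be an asymptotic value. -/
theorem exists_tendsto_lift (h : IsLogarithmicRadius f R) {p γ : ℝ → ℂ} (hp : Continuous p) {T : ℝ}
    (hT : 0 < T) (hpT : R < ‖p T‖) (hγ : ContinuousOn γ (Ico 0 T))
    (hl : ∀ t ∈ Ico 0 T, f (γ t) = p t) :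
    ∃ z, Tendsto γ (𝓝[<] T) (𝓝 z) := by
  have hclose : ∀ c > 0, ∃ t₀ ∈ Ico 0 T, ∀ t ∈ Ico t₀ T, ‖f (γ t) - p T‖ < c := by
    intro c hc
    have := (hp.tendsto T).eventually (Metric.ball_mem_nhds _ hc)
    obtain ⟨δ, hδ, hb⟩ := Metric.eventually_nhds_iff.1 this
    refine ⟨max 0 (T - δ / 2), ⟨by simp, by simp; constructor <;> linarith⟩, fun t ht => ?_⟩
    obtain ⟨h1, h2⟩ := ht
    simp only [max_le_iff] at h1
    rw [hl t ⟨h1.1, h2⟩, ← dist_eq_norm]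
    apply hb
    rw [Real.dist_eq, abs_lt]
    constructor <;> linarith
  -- Either the lift accumulates at some preimage z of p(T), and is then trapped in every small disc
  -- around z, or it accumulates at none of them.
  by_cases hacc : ∃ z, f z = p T ∧ ∀ s > 0, ∀ t₀ ∈ Ico 0 T, ∃ t ∈ Ico t₀ T, γ t ∈ Metric.ball z s
  · obtain ⟨z, hz, hacc⟩ := hacc
    refine ⟨z, ?_⟩
    rw [Metric.tendsto_nhds]
    intro s hs
    obtain ⟨r, hr, hrs, c, hc, hsph⟩ := h.transcendental.exists_sphere_bound z hs
    obtain ⟨t₀, ht₀, hclose⟩ := hclose c hc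
    obtain ⟨t₁, ht₁, hmem⟩ := hacc r hr t₀ ht₀
    have hpre : IsPreconnected (γ '' Ico t₀ T) :=
      isPreconnected_Ico.image _ (hγ.mono (Ico_subset_Ico_left ht₀.1))
    have hsub := IsPreconnected.subset_ball_of_forall_sphere_not_mem hpre (z := z) (r := r) ?_
      (mem_image_of_mem γ ht₁) hmem
    · have : ∀ᶠ t in 𝓝[<] T, t ∈ Ico t₀ T := Ico_mem_nhdsLT ht₀.2
      filter_upwards [this] with t ht
      exact (Metric.mem_ball.1 (hsub (mem_image_of_mem γ ht))).trans_le hrs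
    · rintro w hw ⟨t, ht, rfl⟩
      have := hsph _ hw
      rw [hz] at this
      exact absurd (hclose t ht) (not_lt.2 this)
  · exfalso
    push Not at hacc
    choose! τ hτ hτc using hclose
    -- The components containing the tail of γ decrease with r. A point common to all of them would
    -- be a preimage of p(T) at which γ accumulates.
    refine h.not_asymptotic (p T) hpT
      ⟨fun r => connectedComponentIn (f ⁻¹' Metric.ball (p T) r) (γ (τ r)), ?_, ?_, ?_⟩
    · intro r hr
      exact ⟨γ (τ r), by
        simpa [dist_eq_norm] using hτc r hr (τ r) ⟨le_rfl, (hτ r hr).2⟩, rfl⟩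
    · intro r' r hr' hrr
      have hr := hr'.trans hrr
      have hsub : f ⁻¹' Metric.ball (p T) r' ⊆ f ⁻¹' Metric.ball (p T) r :=
        preimage_mono (Metric.ball_subset_ball hrr.le)
      have htail : ∀ q > 0, γ '' Ico (τ q) T ⊆ connectedComponentIn (f ⁻¹' Metric.ball (p T) q)
          (γ (τ q)) := by
        intro q hq
        refine (isPreconnected_Ico.image _ (hγ.mono
          (Ico_subset_Ico_left (hτ q hq).1))).subset_connectedComponentIn
            (mem_image_of_mem γ ⟨le_rfl, (hτ q hq).2⟩) ?_
        rintro _ ⟨t, ht, rfl⟩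
        simpa [dist_eq_norm] using hτc q hq t ht
      set m := max (τ r) (τ r')
      have hm : m < T := max_lt (hτ r hr).2 (hτ r' hr').2
      have h1 := htail r hr (mem_image_of_mem γ ⟨le_max_left _ _, hm⟩)
      have h2 := htail r' hr' (mem_image_of_mem γ ⟨le_max_right _ _, hm⟩)
      change connectedComponentIn _ _ ⊆ connectedComponentIn _ _
      rw [connectedComponentIn_eq h1, connectedComponentIn_eq h2]
      exact connectedComponentIn_mono _ hsub
    · rw [eq_empty_iff_forall_notMem]
      intro z hz
      simp only [mem_iInter, mem_Ioi] at hz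
      have hfz : f z = p T := by
        by_contra hne
        have hpos : 0 < ‖f z - p T‖ := norm_pos_iff.2 (sub_ne_zero.2 hne)
        have := connectedComponentIn_subset _ _ (hz _ hpos)
        simp [dist_eq_norm] at this
      obtain ⟨s, hs, t₀, ht₀, hns⟩ := hacc z hfz
      obtain ⟨r, hr, hrs, c, hc, hsph⟩ := h.transcendental.exists_sphere_bound z hs
      have hsub := IsPreconnected.subset_ball_of_forall_sphere_not_mem
        (isPreconnected_connectedComponentIn (x := γ (τ c)) (F := f ⁻¹' Metric.ball (p T) c))
        (z := z) (r := r) ?_ (hz c hc) (Metric.mem_ball_self hr)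
      · set m := max t₀ (τ c)
        have hm : m < T := max_lt ht₀.2 (hτ c hc).2
        refine hns m ⟨le_max_left _ _, hm⟩ (Metric.ball_subset_ball hrs (hsub ?_))
        refine (isPreconnected_Ico.image _ (hγ.mono
          (Ico_subset_Ico_left (hτ c hc).1))).subset_connectedComponentIn
            (mem_image_of_mem γ ⟨le_rfl, (hτ c hc).2⟩) ?_
            (mem_image_of_mem γ ⟨le_max_right _ _, hm⟩)
        rintro _ ⟨t, ht, rfl⟩
        simpa [dist_eq_norm] using hτc c hc t ht
      · intro w hw hmem
        have h1 := hsph w hw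
        have h2 := connectedComponentIn_subset _ _ hmem
        rw [hfz] at h1
        simp [dist_eq_norm] at h2
        linarith

/-- `f` has the path lifting property over the complement of the disc of radius `R`. -/
theorem exists_path_lift (h : IsLogarithmicRadius f R) {p : ℝ → ℂ} (hp : Continuous p)
    (hpR : ∀ t ∈ Icc (0 : ℝ) 1, R < ‖p t‖) {z₀ : ℂ} (hz₀ : f z₀ = p 0) :
    ∃ γ : ℝ → ℂ, ContinuousOn γ (Icc 0 1) ∧ γ 0 = z₀ ∧ ∀ t ∈ Icc (0 : ℝ) 1, f (γ t) = p t := by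
  -- Continuation in the endpoint: `A` is closed by `exists_tendsto_lift`, and can be extended to
  -- the right by a local inverse of `f`.
  set A : Set ℝ := {t | ∃ γ : ℝ → ℂ, ContinuousOn γ (Icc 0 t) ∧ γ 0 = z₀ ∧
    ∀ s ∈ Icc (0 : ℝ) t, f (γ s) = p s} with hA
  have hdown : ∀ t ∈ A, ∀ s ≤ t, s ∈ A := by
    rintro t ⟨γ, h1, h2, h3⟩ s hst
    exact ⟨γ, h1.mono (Icc_subset_Icc_right hst), h2, fun x hx => h3 x ⟨hx.1, hx.2.trans hst⟩⟩
  suffices Icc (0 : ℝ) 1 ⊆ A from this ⟨zero_le_one, le_rfl⟩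
  refine IsClosed.Icc_subset_of_forall_mem_nhdsWithin ?_ ?_ ?_
  · refine isClosed_of_closure_subset fun T hT => ?_
    have hT01 : T ∈ Icc (0 : ℝ) 1 :=
      isClosed_Icc.closure_subset_iff.2 inter_subset_right hT
    refine ⟨?_, hT01⟩
    by_contra hTA
    have hlt : ∀ t < T, t ∈ A := by
      intro t ht
      obtain ⟨a, ha1, ha2⟩ := mem_closure_iff.1 hT (Ioi t) isOpen_Ioi ht
      exact hdown a ha2.1 t (le_of_lt ha1)
    have hTpos : 0 < T := by
      rcases hT01.1.lt_or_eq with h0 | h0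
      · exact h0
      · refine absurd ⟨fun _ => z₀, continuousOn_const, rfl, fun s hs => ?_⟩ hTA
        rw [← h0] at hs
        rw [le_antisymm hs.2 hs.1, hz₀]
    choose! Γ hΓc hΓ0 hΓl using hlt
    -- By uniqueness the lifts `Γ t` agree on common intervals, so the diagonal s ↦ Γ s s is a
    -- single lift on [0, T).
    have heq : ∀ t < T, ∀ s ∈ Icc 0 t, Γ s s = Γ t s := by
      intro t ht s hs
      have hsT := hs.2.trans_lt ht
      refine h.eqOn_of_comp_eqOn (isPreconnected_Icc (a := (0 : ℝ)) (b := s)) (hΓc s hsT)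
        ((hΓc t ht).mono (Icc_subset_Icc_right hs.2)) (fun x hx => ?_) (fun x hx => ?_)
        (a := 0) ⟨le_rfl, hs.1⟩ ?_ ⟨hs.1, le_rfl⟩
      · rw [hΓl s hsT x hx, hΓl t ht x ⟨hx.1, hx.2.trans hs.2⟩]
      · rw [hΓl s hsT x hx]
        exact hpR x ⟨hx.1, (hx.2.trans hsT.le).trans hT01.2⟩
      · rw [hΓ0 s hsT, hΓ0 t ht]
    have hc : ContinuousOn (fun s => Γ s s) (Ico 0 T) := by
      intro s hs
      obtain ⟨t, hst, htT⟩ := exists_between hs.2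
      have h1 : ContinuousWithinAt (Γ t) (Icc 0 t) s := hΓc t htT s ⟨hs.1, hst.le⟩
      have h2 : ContinuousWithinAt (fun s => Γ s s) (Icc 0 t) s :=
        h1.congr (fun x hx => heq t htT x hx) (heq t htT s ⟨hs.1, hst.le⟩)
      refine h2.mono_of_mem_nhdsWithin ?_
      have h3 : Iio t ∈ 𝓝 s := Iio_mem_nhds hst
      filter_upwards [mem_nhdsWithin_of_mem_nhds h3, self_mem_nhdsWithin] with x hx1 hx2
      exact ⟨hx2.1, le_of_lt hx1⟩
    have hl : ∀ s ∈ Ico 0 T, f (Γ s s) = p s := fun s hs => hΓl s hs.2 s ⟨hs.1, le_rfl⟩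
    obtain ⟨z, hz⟩ := h.exists_tendsto_lift hp hTpos (hpR T hT01) hc hl
    refine hTA ⟨Function.update (fun s => Γ s s) T z, ?_, ?_, ?_⟩
    · rw [continuousOn_update_iff]
      have hI : Icc 0 T \ {T} = Ico 0 T := Icc_sdiff_right
      rw [hI]
      refine ⟨hc, fun _ => hz.mono_left (nhdsWithin_mono _ fun x hx => hx.2)⟩
    · rw [Function.update_of_ne hTpos.ne]
      exact hΓ0 0 hTpos
    · intro s hs
      rcases hs.2.lt_or_eq with hsT | rfl
      · rw [Function.update_of_ne hsT.ne]
        exact hl s ⟨hs.1, hsT⟩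
      · rw [Function.update_self]
        have h1 : Tendsto (fun t => f (Γ t t)) (𝓝[<] s) (𝓝 (f z)) :=
          (h.transcendental.entire.continuous.tendsto z).comp hz
        have h2 : Tendsto (fun t => f (Γ t t)) (𝓝[<] s) (𝓝 (p s)) := by
          refine ((hp.tendsto s).mono_left nhdsWithin_le_nhds).congr' ?_
          filter_upwards [Ico_mem_nhdsLT hTpos] with t ht
          exact (hl t ht).symm
        exact tendsto_nhds_unique h1 h2
  · refine ⟨fun _ => z₀, continuousOn_const, rfl, fun s hs => ?_⟩
    rw [le_antisymm hs.2 hs.1, hz₀]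
  · rintro x ⟨⟨γ, hγc, hγ0, hγl⟩, hx0, hx1⟩
    have hxl := hγl x ⟨hx0, le_rfl⟩
    have hxR : R < ‖f (γ x)‖ := by
      rw [hxl]; exact hpR x ⟨hx0, hx1.le⟩
    have hs : HasStrictDerivAt f (deriv f (γ x)) (γ x) :=
      (h.transcendental.entire.analyticAt _).hasStrictDerivAt
    obtain ⟨e, hes, hef⟩ : ∃ e : OpenPartialHomeomorph ℂ ℂ, γ x ∈ e.source ∧ ⇑e = f :=
      ⟨(hs.hasStrictFDerivAt_equiv (h.deriv_ne_zero _ hxR)).toOpenPartialHomeomorph f,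
      (hs.hasStrictFDerivAt_equiv (h.deriv_ne_zero _ hxR)).mem_toOpenPartialHomeomorph_source, rfl⟩
    have htgt : p x ∈ e.target := by
      rw [← hxl, ← hef]; exact e.map_source hes
    have hnb : p ⁻¹' e.target ∈ 𝓝 x := hp.continuousAt.preimage_mem_nhds
      (e.open_target.mem_nhds htgt)
    obtain ⟨δ, hδ, hball⟩ := Metric.mem_nhds_iff.1 hnb
    have hIoo : Ioo x (x + δ) ∈ 𝓝[>] x := Ioo_mem_nhdsGT (by linarith)
    filter_upwards [hIoo] with t ht
    have hmem : ∀ s ∈ Icc x t, p s ∈ e.target := by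
      intro s hs
      refine hball ?_
      rw [Metric.mem_ball, Real.dist_eq, abs_lt]
      constructor <;> linarith [hs.1, hs.2, ht.2]
    have hsymm : e.symm (p x) = γ x := by
      rw [← hxl, ← hef]; exact e.left_inv hes
    refine ⟨fun s => if s ≤ x then γ s else e.symm (p s), ?_, by simp [hx0, hγ0], ?_⟩
    · refine ContinuousOn.if ?_ ?_ ?_
      · rintro a ⟨ha, haf⟩
        have : a = x := by
          have := frontier_Iic_subset _ haf
          simpa using this
        subst this
        exact hsymm.symm
      · refine hγc.mono fun s hs => ⟨hs.1.1, ?_⟩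
        have : closure {a | a ≤ x} = Iic x := isClosed_Iic.closure_eq
        rw [this] at hs
        exact hs.2
      · have hcl : Icc 0 t ∩ closure {a | ¬ a ≤ x} ⊆ Icc x t := by
          rintro s ⟨hs1, hs2⟩
          have : {a | ¬ a ≤ x} = Ioi x := by ext; simp
          rw [this, closure_Ioi] at hs2
          exact ⟨hs2, hs1.2⟩
        exact (e.continuousOn_symm.comp hp.continuousOn hmem).mono hcl
    · intro s hs
      by_cases hsx : s ≤ x
      · simp only [hsx, if_true]
        exact hγl s ⟨hs.1, hsx⟩
      · simp only [hsx, if_false]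
        rw [← hef]
        exact e.right_inv (hmem s ⟨le_of_not_ge hsx, hs.2⟩)

/-! ### Holomorphic inverse branches on a half-plane. -/

theorem lt_norm_exp_iff (h : IsLogarithmicRadius f R) {u : ℂ} :
    R < ‖Complex.exp u‖ ↔ Real.log R < u.re := by
  rw [Complex.norm_exp, Real.log_lt_iff_lt_exp h.pos]

end IsLogarithmicRadius

theorem differentiableAt_of_comp_eventuallyEq {f G g : ℂ → ℂ} {u : ℂ} (hf : AnalyticAt ℂ f (G u))
    (hne : deriv f (G u) ≠ 0) (hG : ContinuousAt G u) (hg : DifferentiableAt ℂ g u)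
    (hfG : ∀ᶠ v in 𝓝 u, f (G v) = g v) : DifferentiableAt ℂ G u := by
  have hs := hf.hasStrictDerivAt
  have hinv : DifferentiableAt ℂ (hs.localInverse f _ _ hne) (g u) := by
    rw [← hfG.self_of_nhds]
    exact (hs.to_localInverse hne).hasDerivAt.differentiableAt
  refine (hinv.comp u hg).congr_of_eventuallyEq ?_
  have hleft := hG.eventually (hs.hasStrictFDerivAt_equiv hne).eventually_left_inverse
  filter_upwards [hleft, hfG] with v hv hv'
  rw [Function.comp_apply, ← hv']
  exact hv.symm

theorem isOpen_rightHalfPlane (a : ℝ) : IsOpen {u : ℂ | a < u.re} :=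
  isOpen_lt continuous_const Complex.continuous_re

namespace IsLogarithmicRadius

variable {f : ℂ → ℂ} {R : ℝ}

/-- Existence of the inverse branches of `f` in the logarithmic coordinate of the range. -/
theorem exists_inverse_branch (h : IsLogarithmicRadius f R) {u₀ z₀ : ℂ} (hu₀ : Real.log R < u₀.re)
    (hz₀ : f z₀ = Complex.exp u₀) :
    ∃ G : ℂ → ℂ, ContinuousOn G {u | Real.log R < u.re} ∧ G u₀ = z₀ ∧
      ∀ u, Real.log R < u.re → f (G u) = Complex.exp u := by
  classical
  set H : Set ℂ := {u | Real.log R < u.re} with hH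
  have hseg : ∀ u ∈ H, ∀ t ∈ Icc (0 : ℝ) 1, u₀ + t * (u - u₀) ∈ H := by
    intro u hu t ht
    simpa [hH] using (convex_halfSpace_re_gt (Real.log R)).add_smul_sub_mem hu₀ hu ht
  -- The half-plane is convex, so the branch can be defined by lifting the exponential of each
  -- segment from u₀ and taking the endpoint of the lift.
  have hpaths : ∀ u : H, ∃ γ : ℝ → ℂ, ContinuousOn γ (Icc 0 1) ∧ γ 0 = z₀ ∧
      ∀ t ∈ Icc (0 : ℝ) 1, f (γ t) = Complex.exp (u₀ + t * (u - u₀)) := by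
    intro u
    refine h.exists_path_lift (p := fun t : ℝ => Complex.exp (u₀ + t * (u - u₀)))
      (by fun_prop) (fun t ht => h.lt_norm_exp_iff.2 (hseg u u.2 t ht)) (by simpa using hz₀)
  choose γ hγc hγ0 hγl using hpaths
  have hE : ∀ (t : unitInterval) (u : H), R < ‖f (γ u t)‖ := fun t u => by
    rw [hγl u t t.2]; exact h.lt_norm_exp_iff.2 (hseg u u.2 t t.2)
  -- Lifts that are continuous along each segment, with continuous initial values, are jointly
  -- continuous.
  have hcont := h.isLocalHomeomorph.continuous_lift (isSeparatedMap f R) (A := H)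
    ⟨fun x : unitInterval × H => Complex.exp (u₀ + ((x.1 : ℝ) : ℂ) * (x.2 - u₀)), by fun_prop⟩
    (g := fun x => ⟨γ x.2 x.1, hE x.1 x.2⟩)
    (by
      funext x
      exact hγl x.2 x.1 x.1.2)
    (by
      have : (fun u : H => (⟨γ u (0 : unitInterval), hE 0 u⟩ : {z : ℂ // R < ‖f z‖})) =
          fun u => ⟨z₀, by rw [hz₀]; exact h.lt_norm_exp_iff.2 hu₀⟩ := by
        funext u
        exact Subtype.ext (hγ0 u)
      change Continuous (fun u : H => (⟨γ u (0 : unitInterval), hE 0 u⟩ : {z : ℂ // R < ‖f z‖}))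
      rw [this]
      exact continuous_const)
    (by
      intro u
      refine Continuous.subtype_mk ?_ _
      exact (hγc u).comp_continuous continuous_subtype_val fun t => t.2)
  refine ⟨fun u => if hu : u ∈ H then γ ⟨u, hu⟩ 1 else 0, ?_, ?_, ?_⟩
  · rw [continuousOn_iff_continuous_domRestrict]
    have h1 : Continuous fun u : H => γ u 1 :=
      continuous_subtype_val.comp (hcont.comp (Continuous.prodMk_right (1 : unitInterval)))
    convert h1 using 1
    funext u
    simp [u.2]
  · have hu₀' : u₀ ∈ H := hu₀
    simp only [hu₀', dif_pos]
    rw [← hγ0 ⟨u₀, hu₀'⟩]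
    refine h.eqOn_of_comp_eqOn (isPreconnected_Icc (a := (0 : ℝ)) (b := 1)) (hγc ⟨u₀, hu₀'⟩)
      (g₂ := fun _ => γ ⟨u₀, hu₀'⟩ 0) continuousOn_const (fun x hx => ?_) (fun x hx => ?_)
      (a := 0) (by simp) rfl (by simp)
    · rw [hγl _ x hx, hγ0, hz₀]; simp
    · exact hE ⟨x, hx⟩ _
  · intro u hu
    have hu' : u ∈ H := hu
    simp only [hu', dif_pos]
    rw [hγl ⟨u, hu'⟩ 1 (by simp)]
    simp

theorem differentiableOn_of_comp_eq_exp (h : IsLogarithmicRadius f R) {G : ℂ → ℂ}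
    (hG : ContinuousOn G {u | Real.log R < u.re})
    (hl : ∀ u, Real.log R < u.re → f (G u) = Complex.exp u) :
    DifferentiableOn ℂ G {u | Real.log R < u.re} := by
  intro u hu
  have hnb := (isOpen_rightHalfPlane (Real.log R)).mem_nhds hu
  refine (differentiableAt_of_comp_eventuallyEq (h.transcendental.entire.analyticAt _)
    (h.deriv_ne_zero _ ?_) (hG.continuousAt hnb) Complex.differentiable_exp.differentiableAt
    ?_).differentiableWithinAt
  · rw [hl u hu]
    exact h.lt_norm_exp_iff.2 hu
  · filter_upwards [hnb] with v hv using hl v hv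

end IsLogarithmicRadius

/-! ### Injectivity of the inverse branches. -/

theorem exists_polynomial_of_frequently_norm_le {f : ℂ → ℂ} (hf : Differentiable ℂ f) (k : ℕ)
    (C : ℝ) (hb : ∃ᶠ r : ℝ in atTop, ∀ z, ‖z‖ = r → ‖f z‖ ≤ C * r ^ k) :
    ∃ p : Polynomial ℂ, ∀ z, f z = p.eval z := by
  -- Cauchy's estimate on arbitrarily large circles kills every Taylor coefficient of order above k.
  have hz : ∀ n, k < n → iteratedDeriv n f 0 = 0 := by
    intro n hn
    rw [← norm_le_zero_iff]
    have hlim : Tendsto (fun r : ℝ => n.factorial * |C| * r⁻¹) atTop (𝓝 0) := by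
      simpa using tendsto_inv_atTop_zero.const_mul (n.factorial * |C|)
    refine ge_of_tendsto_of_frequently hlim ?_
    refine (hb.and_eventually (eventually_ge_atTop 1)).mono fun r hr => ?_
    obtain ⟨hr, hr1⟩ := hr
    have hr0 : 0 < r := by linarith
    have := Complex.norm_iteratedDeriv_le_of_forall_mem_sphere_norm_le n hr0
      (c := 0) (C := C * r ^ k) hf.diffContOnCl (fun z hz => hr z (by simpa using hz))
    refine this.trans ?_
    rw [← mul_assoc, mul_div_assoc, mul_assoc, mul_assoc]
    have h1 : r ^ k / r ^ n ≤ r⁻¹ := by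
      rw [div_le_iff₀ (by positivity)]
      calc r ^ k = r⁻¹ * r ^ (k + 1) := by rw [pow_succ]; field_simp
        _ ≤ r⁻¹ * r ^ n := by gcongr; exact hn
    gcongr
    exact le_abs_self C
  refine ⟨∑ n ∈ Finset.range (k + 1),
    Polynomial.C ((n.factorial : ℂ)⁻¹ * iteratedDeriv n f 0) * Polynomial.X ^ n, fun z => ?_⟩
  have h1 := Complex.hasSum_taylorSeries_of_entire hf 0 z
  have h2 : HasSum (fun n : ℕ => ((n.factorial : ℂ))⁻¹ • (z - 0) ^ n • iteratedDeriv n f 0)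
      (∑ n ∈ Finset.range (k + 1), ((n.factorial : ℂ))⁻¹ • (z - 0) ^ n • iteratedDeriv n f 0) :=
    hasSum_sum_of_ne_finset_zero fun n hn => by
      rw [hz n (by simpa using hn)]; simp
  rw [h1.unique h2, Polynomial.eval_finsetSum]
  refine Finset.sum_congr rfl fun n _ => ?_
  simp
  ring

/-- A branch, on the half-plane `Re u > log R`, of the inverse of `f` in logarithmic coordinates of
both the domain and the range. -/
structure IsLogBranch (f : ℂ → ℂ) (R : ℝ) (L : ℂ → ℂ) : Prop where
  differentiableOn : DifferentiableOn ℂ L {u | Real.log R < u.re}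
  map_exp : ∀ u, Real.log R < u.re → f (Complex.exp (L u)) = Complex.exp u

namespace IsLogarithmicRadius

variable {f : ℂ → ℂ} {R : ℝ}

theorem ne_zero_of_lt_norm (h : IsLogarithmicRadius f R) {z : ℂ} (hz : R < ‖f z‖) : z ≠ 0 := by
  rintro rfl
  exact absurd hz (not_lt.2 h.norm_zero_le)

/-- An inverse branch is not periodic: otherwise `f` would have polynomial growth. -/
theorem not_periodic_inverse_branch (h : IsLogarithmicRadius f R) {G : ℂ → ℂ}
    (hG : DifferentiableOn ℂ G {u | Real.log R < u.re})
    (hl : ∀ u, Real.log R < u.re → f (G u) = Complex.exp u) {k : ℕ} (hk : 0 < k)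
    (hper : ∀ u, Real.log R < u.re → G (u + k * (2 * Real.pi * Complex.I)) = G u) : False := by
  classical
  have hGne : ∀ u, Real.log R < u.re → G u ≠ 0 := fun u hu =>
    h.ne_zero_of_lt_norm (by rw [hl u hu]; exact h.lt_norm_exp_iff.2 hu)
  set T : ℝ := 2 * Real.pi * k with hT
  have hT0 : 0 < T := by positivity
  -- After rotation to an upper half-plane, 1/G has period T = 2πk, hence is a function `c` of q =
  -- exp(2πiz/T) near q = 0.
  set F : ℂ → ℂ := fun z => if Real.log R < z.im then (G (-Complex.I * z))⁻¹ else 0 with hF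
  have hre : ∀ z : ℂ, (-Complex.I * z).re = z.im := fun z => by simp
  have hFper : Function.Periodic F (T : ℂ) := by
    intro z
    have him : (z + (T : ℂ)).im = z.im := by simp
    simp only [hF, him]
    split_ifs with hz
    · have h1 : Real.log R < (-Complex.I * (z + (T : ℂ))).re := by rw [hre, him]; exact hz
      rw [← hper _ h1]
      congr 2
      simp only [hT]
      push_cast
      ring
    · rfl
  have hFd : ∀ z : ℂ, Real.log R < z.im → DifferentiableAt ℂ F z := by
    intro z hz
    have h1 : DifferentiableAt ℂ (fun z => (G (-Complex.I * z))⁻¹) z := by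
      have h2 : DifferentiableAt ℂ G (-Complex.I * z) :=
        hG.differentiableAt ((isOpen_rightHalfPlane _).mem_nhds
          (by simpa [hre] using hz))
      exact (h2.comp z (by fun_prop)).inv (hGne _ (by rw [hre]; exact hz))
    refine h1.congr_of_eventuallyEq ?_
    filter_upwards [(isOpen_lt continuous_const Complex.continuous_im).mem_nhds hz] with w hw
    exact if_pos hw
  have hlarge : ∀ a : ℝ, ∀ᶠ z in comap Complex.im atTop, a < z.im := fun a =>
    tendsto_comap.eventually (eventually_gt_atTop a)
  have hev : ∀ᶠ z in comap Complex.im atTop, DifferentiableAt ℂ F z :=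
    (hlarge (Real.log R)).mono hFd
  -- `G` tends to infinity: `f` is bounded on compact sets, while |f(G u)| = exp(Re u) is unbounded.
  have hzero : ZeroAtFilter (comap Complex.im atTop) F := by
    rw [ZeroAtFilter, Metric.tendsto_nhds]
    intro ε hε
    obtain ⟨B, hB⟩ := (isCompact_closedBall (0 : ℂ) ε⁻¹).exists_bound_of_continuousOn
      h.transcendental.entire.continuous.continuousOn
    filter_upwards [hlarge (Real.log R), hlarge (Real.log (max B 1))] with z hz1 hz2
    have hu : Real.log R < (-Complex.I * z).re := by rw [hre]; exact hz1
    have h1 : ε⁻¹ < ‖G (-Complex.I * z)‖ := by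
      by_contra hcon
      have h2 := hB _ (mem_closedBall_zero_iff.2 (not_lt.1 hcon))
      rw [hl _ hu, Complex.norm_exp, hre] at h2
      rw [Real.log_lt_iff_lt_exp (by positivity)] at hz2
      linarith [le_max_left B 1]
    simp only [hF, hz1, if_true, dist_zero_right, norm_inv]
    exact inv_lt_of_inv_lt₀ hε h1
  have hbdd : BoundedAtFilter (comap Complex.im atTop) F := hzero.boundedAtFilter
  set c := Function.Periodic.cuspFunction T F with hc
  have hc0 : c 0 = 0 := Function.Periodic.cuspFunction_zero_of_zero_at_inf hT0 hzero
  have hcd : DifferentiableAt ℂ c 0 :=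
    Function.Periodic.differentiableAt_cuspFunction_zero hT0 hFper hev hbdd
  have hcev : ∀ᶠ q in 𝓝 0, DifferentiableAt ℂ c q := by
    have := Function.Periodic.eventually_differentiableAt_cuspFunction_nhds_ne_zero hT0 hFper hev
    rw [eventually_nhdsWithin_iff] at this
    filter_upwards [this] with q hq
    by_cases hq0 : q = 0
    · rw [hq0]; exact hcd
    · exact hq hq0
  have hca : AnalyticAt ℂ c 0 := Complex.analyticAt_iff_eventually_differentiableAt.2 hcev
  have hcF : ∀ z, c (Function.Periodic.qParam T z) = F z :=
    Function.Periodic.eq_cuspFunction hT0.ne' hFper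
  -- The extended `c` vanishes at 0 without being constant, so it is open there; thus every large z
  -- is a value of `G`.
  have hopen : 𝓝 0 ≤ map c (𝓝 0) := by
    rcases hca.eventually_constant_or_nhds_le_map_nhds with hconst | hle
    · exfalso
      have h1 := (Function.Periodic.qParam_tendsto hT0).eventually
        (eventually_nhdsWithin_of_eventually_nhds hconst)
      have : (comap Complex.im atTop).NeBot := by
        refine comap_neBot fun s hs => ?_
        obtain ⟨a, ha⟩ := Filter.nonempty_of_mem hs
        exact ⟨⟨0, a⟩, ha⟩
      obtain ⟨z, hz, hz1⟩ := (h1.and (hlarge (Real.log R))).exists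
      rw [hcF, hc0] at hz
      simp only [hF, hz1, if_true, inv_eq_zero] at hz
      exact hGne _ (by rw [hre]; exact hz1) hz
    · rwa [hc0] at hle
  obtain ⟨K, hK⟩ := hcd.isBigO_sub.bound
  simp only [hc0, sub_zero] at hK
  have hgood : ∀ᶠ q in 𝓝 (0 : ℂ), ‖c q‖ ≤ K * ‖q‖ ∧
      (q ≠ 0 → Real.log R < (Function.Periodic.invQParam T q).im) := by
    have h1 := (Function.Periodic.invQParam_tendsto hT0).eventually (hlarge (Real.log R))
    rw [eventually_nhdsWithin_iff] at h1
    filter_upwards [hK, h1] with q hq1 hq2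
    exact ⟨hq1, fun hq => hq2 hq⟩
  have himg := hopen (image_mem_map hgood)
  have hinf : ∀ᶠ z : ℂ in cocompact ℂ, z⁻¹ ∈ c '' {q | ‖c q‖ ≤ K * ‖q‖ ∧
      (q ≠ 0 → Real.log R < (Function.Periodic.invQParam T q).im)} :=
    (tendsto_inv₀_cobounded (α := ℂ)).eventually himg |>.filter_mono
      (by rw [Metric.cobounded_eq_cocompact])
  have hbound : ∀ᶠ z : ℂ in cocompact ℂ, ‖f z‖ ≤ K ^ k * ‖z‖ ^ k := by
    have hne : ∀ᶠ z : ℂ in cocompact ℂ, z ≠ 0 := by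
      have : ({0} : Set ℂ)ᶜ ∈ cocompact ℂ := isCompact_singleton.compl_mem_cocompact
      exact this
    filter_upwards [hinf, hne] with z ⟨q, ⟨hq1, hq2⟩, hqz⟩ hz
    have hq0 : q ≠ 0 := by
      rintro rfl
      rw [hc0] at hqz
      exact inv_ne_zero hz hqz.symm
    set w := Function.Periodic.invQParam T q with hw
    have hqw : Function.Periodic.qParam T w = q := Function.Periodic.qParam_right_inv hT0.ne' hq0
    have hwim := hq2 hq0
    have hu : Real.log R < (-Complex.I * w).re := by rw [hre]; exact hwim
    have hGz : G (-Complex.I * w) = z := by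
      have := hcF w
      rw [hqw, hqz] at this
      simp only [hF, hwim, if_true] at this
      exact (inv_injective this).symm
    have hfz : ‖f z‖ = Real.exp w.im := by
      rw [← hGz, hl _ hu, Complex.norm_exp, hre]
    have hqn : ‖q‖ = Real.exp (-w.im / k) := by
      rw [← hqw, Function.Periodic.norm_qParam, hT]
      congr 1
      field_simp
    have hz0 : 0 < ‖z‖ := norm_pos_iff.2 hz
    -- Here |q| = exp(−Im w/k) and 1/|z| = |c(q)| ≤ K|q|. The k-th power bounds |f(z)| = exp(Im w)
    -- by (K|z|)^k.
    have h3 : Real.exp (w.im / k) ≤ K * ‖z‖ := by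
      rw [hqz, norm_inv, hqn, neg_div, Real.exp_neg] at hq1
      rw [inv_le_iff_one_le_mul₀ hz0] at hq1
      have hE := Real.exp_pos (w.im / k)
      have : K * (Real.exp (w.im / k))⁻¹ * ‖z‖ = K * ‖z‖ / Real.exp (w.im / k) := by ring
      rw [this, one_le_div hE] at hq1
      exact hq1
    rw [hfz, ← mul_pow]
    calc Real.exp w.im = Real.exp (w.im / k) ^ k := by
          rw [← Real.exp_nat_mul]; congr 1; field_simp
      _ ≤ _ := by gcongr
  refine h.transcendental.not_polynomial (exists_polynomial_of_frequently_norm_le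
    h.transcendental.entire k (K ^ k) (Eventually.frequently ?_))
  rw [← Metric.cobounded_eq_cocompact, ← comap_norm_atTop, eventually_comap] at hbound
  filter_upwards [hbound] with r hr z hz
  have := hr z hz
  rwa [hz] at this

/-- A common value forces exp a = exp b, so a − b is a multiple of 2πi. Translating by it gives two
lifts of exp that agree at `b`, hence everywhere. -/
theorem eqOn_translate_of_eq (h : IsLogarithmicRadius f R) {G₁ G₂ : ℂ → ℂ}
    (hG₁ : ContinuousOn G₁ {u | Real.log R < u.re}) (hG₂ : ContinuousOn G₂ {u | Real.log R < u.re})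
    (hl₁ : ∀ u, Real.log R < u.re → f (G₁ u) = Complex.exp u)
    (hl₂ : ∀ u, Real.log R < u.re → f (G₂ u) = Complex.exp u) {a b : ℂ}
    (ha : Real.log R < a.re) (hb : Real.log R < b.re) (hab : G₁ a = G₂ b) :
    ∃ n : ℤ, a = b + n * (2 * Real.pi * Complex.I) ∧
      ∀ u, Real.log R < u.re → G₁ (u + n * (2 * Real.pi * Complex.I)) = G₂ u := by
  have hexp : Complex.exp a = Complex.exp b := by rw [← hl₁ a ha, ← hl₂ b hb, hab]
  obtain ⟨n, hn⟩ := Complex.exp_eq_exp_iff_exists_int.1 hexp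
  refine ⟨n, hn, ?_⟩
  have hre : ∀ u : ℂ, (u + n * (2 * Real.pi * Complex.I)).re = u.re := fun u => by simp
  have hlt : ∀ u : ℂ, Real.log R < u.re →
      f (G₁ (u + n * (2 * Real.pi * Complex.I))) = Complex.exp u := fun u hu => by
    rw [hl₁ _ (by rw [hre]; exact hu), Complex.exp_eq_exp_iff_exists_int]
    exact ⟨n, rfl⟩
  have := h.eqOn_of_comp_eqOn (S := {u : ℂ | Real.log R < u.re})
    (convex_halfSpace_re_gt (Real.log R)).isPreconnected
    (g₁ := fun u => G₁ (u + n * (2 * Real.pi * Complex.I))) (g₂ := G₂)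
    (hG₁.comp (by fun_prop) fun u hu => by
      change Real.log R < _
      rw [hre]; exact hu) hG₂
    (fun u hu => by rw [hlt u hu, hl₂ u hu])
    (fun u hu => by rw [hlt u hu]; exact h.lt_norm_exp_iff.2 hu) (a := b) hb
    (by rw [← hn, hab])
  exact fun u hu => this hu

theorem injOn_inverse_branch (h : IsLogarithmicRadius f R) {G : ℂ → ℂ}
    (hG : DifferentiableOn ℂ G {u | Real.log R < u.re})
    (hl : ∀ u, Real.log R < u.re → f (G u) = Complex.exp u) :
    InjOn G {u | Real.log R < u.re} := by
  intro a ha b hb hab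
  obtain ⟨n, hn, hper⟩ := h.eqOn_translate_of_eq hG.continuousOn hG.continuousOn hl hl ha hb hab
  have hre : ∀ (m : ℤ) (u : ℂ), (u + m * (2 * Real.pi * Complex.I)).re = u.re := fun m u => by simp
  rcases lt_trichotomy n 0 with h0 | h0 | h0
  · exfalso
    obtain ⟨k, rfl⟩ : ∃ k : ℕ, n = -(k : ℤ) := ⟨n.natAbs, by omega⟩
    refine h.not_periodic_inverse_branch hG hl (k := k) (by omega) fun u hu => ?_
    rw [← hper _ (by simpa using hu)]
    congr 1
    push_cast
    ring
  · rw [hn, h0]; simp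
  · exfalso
    obtain ⟨k, rfl⟩ : ∃ k : ℕ, n = (k : ℤ) := ⟨n.natAbs, by omega⟩
    refine h.not_periodic_inverse_branch hG hl (k := k) (by omega) fun u hu => ?_
    simpa using hper u hu

end IsLogarithmicRadius

/-! ### Logarithms of the inverse branches. -/

theorem exists_differentiableOn_log {U : Set ℂ} (hU : Convex ℝ U) (hUo : IsOpen U)
    {g : ℂ → ℂ} (hg : DifferentiableOn ℂ g U) (h0 : ∀ u ∈ U, g u ≠ 0) {u₀ s₀ : ℂ} (hu₀ : u₀ ∈ U)
    (hs₀ : Complex.exp s₀ = g u₀) :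
    ∃ L : ℂ → ℂ, DifferentiableOn ℂ L U ∧ L u₀ = s₀ ∧ ∀ u ∈ U, Complex.exp (L u) = g u := by
  have hsc : IsSimplyConnected U := by
    have := hU.contractibleSpace ⟨u₀, hu₀⟩
    exact (inferInstance : SimplyConnectedSpace U)
  obtain ⟨L, hLc, hL⟩ := Complex.exists_continuousOn_eqOn_exp_comp hsc hUo hg.continuousOn
    (by rintro ⟨u, hu, hu0⟩; exact h0 u hu hu0)
  have hL' : ∀ u ∈ U, Complex.exp (L u) = g u := fun u hu => hL hu
  have hLd : DifferentiableOn ℂ L U := fun u hu => by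
    refine (differentiableAt_of_comp_eventuallyEq (f := Complex.exp) (g := g)
      (Complex.differentiable_exp.analyticAt _) (by simp)
      (hLc.continuousAt (hUo.mem_nhds hu)) (hg.differentiableAt (hUo.mem_nhds hu))
      ?_).differentiableWithinAt
    filter_upwards [hUo.mem_nhds hu] with v hv using hL' v hv
  obtain ⟨n, hn⟩ := Complex.exp_eq_exp_iff_exists_int.1 (hs₀.trans (hL' u₀ hu₀).symm)
  refine ⟨fun u => L u + n * (2 * Real.pi * Complex.I), hLd.add_const _, hn.symm, fun u hu => ?_⟩
  rw [← hL' u hu, Complex.exp_eq_exp_iff_exists_int]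
  exact ⟨n, rfl⟩

namespace IsLogarithmicRadius

variable {f : ℂ → ℂ} {R : ℝ}

theorem exists_isLogBranch (h : IsLogarithmicRadius f R) {u₀ s₀ : ℂ} (hu₀ : Real.log R < u₀.re)
    (hs₀ : f (Complex.exp s₀) = Complex.exp u₀) :
    ∃ L, IsLogBranch f R L ∧ L u₀ = s₀ := by
  obtain ⟨G, hGc, hG0, hG⟩ := h.exists_inverse_branch hu₀ hs₀
  obtain ⟨L, hLd, hL0, hL⟩ := exists_differentiableOn_log (convex_halfSpace_re_gt (Real.log R))
    (isOpen_rightHalfPlane _) (h.differentiableOn_of_comp_eq_exp hGc hG)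
    (fun u hu => h.ne_zero_of_lt_norm (by rw [hG u hu]; exact h.lt_norm_exp_iff.2 hu))
    hu₀ hG0.symm
  exact ⟨L, ⟨hLd, fun u hu => by rw [hL u hu, hG u hu]⟩, hL0⟩

theorem eq_of_exp_eq (h : IsLogarithmicRadius f R) {L : ℂ → ℂ} (hL : IsLogBranch f R L) {a b : ℂ}
    (ha : Real.log R < a.re) (hb : Real.log R < b.re)
    (hab : Complex.exp (L a) = Complex.exp (L b)) : a = b :=
  h.injOn_inverse_branch (G := fun u => Complex.exp (L u)) hL.differentiableOn.cexp hL.map_exp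
    ha hb hab

end IsLogarithmicRadius

/-! ### Bloch's theorem and contraction of the branches. -/

/-- A weak form of Bloch's theorem. -/
theorem exists_ball_subset_image {g : ℂ → ℂ} {c : ℂ} {r : ℝ} (hr : 0 < r)
    (hg : DifferentiableOn ℂ g (Metric.ball c r)) :
    ∃ y, Metric.ball y (r * ‖deriv g c‖ / 96) ⊆ g '' Metric.ball c r := by
  rcases eq_or_ne (deriv g c) 0 with h0 | h0
  · exact ⟨0, by simp [h0]⟩
  have hsub : Metric.closedBall c (r / 2) ⊆ Metric.ball c r :=
    Metric.closedBall_subset_ball (by linarith)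
  have hdd : DifferentiableOn ℂ (deriv g) (Metric.ball c r) := hg.deriv Metric.isOpen_ball
  -- Landau's device: maximising |g'(z)| times the distance to the boundary circle gives |g'| ≤
  -- 2|g'(a)| on the disc around `a` of half that distance.
  obtain ⟨a, ha, hmax⟩ := (isCompact_closedBall c (r / 2)).exists_isMaxOn
    (f := fun z => ‖deriv g z‖ * (r / 2 - ‖z - c‖)) ⟨c, by simp; linarith⟩
    ((hdd.continuousOn.mono hsub).norm.mul (by fun_prop))
  have hmax' : ∀ z ∈ Metric.closedBall c (r / 2),
      ‖deriv g z‖ * (r / 2 - ‖z - c‖) ≤ ‖deriv g a‖ * (r / 2 - ‖a - c‖) := fun z hz => hmax hz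
  set M := ‖deriv g a‖ with hM
  set ρ := (r / 2 - ‖a - c‖) / 2 with hρ
  have hV := hmax' c (by simp; linarith)
  simp only [sub_self, norm_zero, sub_zero] at hV
  have hc0 : 0 < ‖deriv g c‖ := norm_pos_iff.2 h0
  have hVpos : 0 < M * (r / 2 - ‖a - c‖) := lt_of_lt_of_le (by positivity) hV
  have hM0 : 0 < M := by
    rcases (norm_nonneg (deriv g a)).lt_or_eq with h | h
    · exact h
    · rw [hM, ← h, zero_mul] at hVpos; exact absurd hVpos (lt_irrefl _)
  have hρ0 : 0 < ρ := by
    have := (mul_pos_iff_of_pos_left hM0).1 hVpos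
    rw [hρ]; linarith
  have hsub2 : Metric.closedBall a ρ ⊆ Metric.closedBall c (r / 2) := by
    refine Metric.closedBall_subset_closedBall' ?_
    rw [dist_eq_norm]
    linarith
  have hbd : ∀ z ∈ Metric.closedBall a ρ, ‖deriv g z‖ ≤ 2 * M := by
    intro z hz
    have h1 := hmax' z (hsub2 hz)
    have h2 : ‖z - c‖ ≤ ρ + ‖a - c‖ := by
      rw [mem_closedBall_iff_norm] at hz
      calc ‖z - c‖ = ‖(z - a) + (a - c)‖ := by ring_nf
        _ ≤ _ := (norm_add_le _ _).trans (by linarith)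
    have h3 : ‖deriv g z‖ * ρ ≤ 2 * M * ρ := by
      calc ‖deriv g z‖ * ρ ≤ ‖deriv g z‖ * (r / 2 - ‖z - c‖) := by
            gcongr; linarith
        _ ≤ _ := h1
        _ = _ := by rw [hρ]; ring
    exact le_of_mul_le_mul_right h3 hρ0
  have hballsub : Metric.ball a ρ ⊆ Metric.ball c r :=
    Metric.ball_subset_closedBall.trans (hsub2.trans hsub)
  have hschw : ∀ z ∈ Metric.ball a ρ, ‖deriv g z - deriv g a‖ ≤ 3 * M / ρ * ‖z - a‖ := by
    intro z hz
    have := Complex.dist_le_div_mul_dist_of_mapsTo_ball (f := deriv g) (c := a) (R₁ := ρ)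
      (R₂ := 3 * M) (hdd.mono hballsub) (fun w hw => ?_) hz
    · simpa [dist_eq_norm] using this
    · rw [mem_closedBall_iff_norm]
      have := hbd w (Metric.ball_subset_closedBall hw)
      exact (norm_sub_le _ _).trans (by linarith)
  -- With this radius the Schwarz bound 3M/ρ · t equals M/2, so g stays within Mt/2 of its linear
  -- part and |g − g(a)| ≥ Mt/2 on the circle. The covering lemma halves this once more, which
  -- yields the constant 96.
  set t := ρ / 6 with ht
  have ht0 : 0 < t := by positivity
  have htsub : Metric.closedBall a t ⊆ Metric.ball a ρ :=
    Metric.closedBall_subset_ball (by rw [ht]; linarith)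
  have hga : ∀ z ∈ Metric.ball a ρ, HasDerivAt g (deriv g z) z := fun z hz =>
    (hg.differentiableAt (Metric.isOpen_ball.mem_nhds (hballsub hz))).hasDerivAt
  have hlow : ∀ z ∈ Metric.sphere a t, M * t / 2 ≤ ‖g z - g a‖ := by
    intro z hz
    have hz' : ‖z - a‖ = t := mem_sphere_iff_norm.1 hz
    have h1 := Convex.norm_image_sub_le_of_norm_hasDerivWithin_le (𝕜 := ℂ)
      (f := fun z => g z - deriv g a * z) (f' := fun z => deriv g z - deriv g a) (C := M / 2)
      (s := Metric.closedBall a t) (x := a) (y := z)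
      (fun w hw => by
        have := (hga w (htsub hw)).sub ((hasDerivAt_id w).const_mul (deriv g a))
        simp only [mul_one] at this
        exact this.hasDerivWithinAt)
      (fun w hw => by
        refine (hschw w (htsub hw)).trans ?_
        have : ‖w - a‖ ≤ t := mem_closedBall_iff_norm.1 hw
        calc 3 * M / ρ * ‖w - a‖ ≤ 3 * M / ρ * t := by gcongr
          _ = M / 2 := by rw [ht]; field_simp; norm_num)
      (convex_closedBall a t) (by simp [ht0.le]) (Metric.sphere_subset_closedBall hz)
    rw [hz'] at h1
    have h2 : ‖deriv g a * (z - a)‖ = M * t := by rw [norm_mul, hz']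
    have h3 : deriv g a * (z - a) =
        (g z - g a) - ((g z - deriv g a * z) - (g a - deriv g a * a)) := by ring
    rw [h3] at h2
    have h4 := norm_sub_le (g z - g a) ((g z - deriv g a * z) - (g a - deriv g a * a))
    linarith
  have hfreq : ∃ᶠ z in 𝓝 a, g z ≠ g a := by
    have h1 : deriv g a ≠ 0 := norm_pos_iff.1 hM0
    exact ((hga a (Metric.mem_ball_self hρ0)).eventually_ne h1).frequently.filter_mono
      nhdsWithin_le_nhds
  have hdc : DiffContOnCl ℂ g (Metric.ball a t) := by
    refine DifferentiableOn.diffContOnCl ?_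
    rw [closure_ball a ht0.ne']
    exact hg.mono (htsub.trans hballsub)
  refine ⟨g a, Subset.trans ?_ ((hdc.ball_subset_image_closedBall ht0 hlow hfreq).trans
    (image_mono (htsub.trans hballsub)))⟩
  refine Metric.ball_subset_ball ?_
  have : M * t / 2 / 2 = M * (r / 2 - ‖a - c‖) / 48 := by rw [ht, hρ]; ring
  rw [this]
  linarith

theorem norm_deriv_le_of_not_ball_subset_image {g : ℂ → ℂ} {c : ℂ} {r d : ℝ} (hr : 0 < r)
    (hg : DifferentiableOn ℂ g (Metric.ball c r))
    (hd : ∀ y, ¬ Metric.ball y d ⊆ g '' Metric.ball c r) : ‖deriv g c‖ ≤ 96 * d / r := by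
  by_contra hcon
  push Not at hcon
  obtain ⟨y, hy⟩ := exists_ball_subset_image hr hg
  refine hd y ((Metric.ball_subset_ball ?_).trans hy)
  rw [div_lt_iff₀ hr] at hcon
  linarith

namespace IsLogarithmicRadius

variable {f : ℂ → ℂ} {R : ℝ}

/-- A disc of radius 7 > 2π contains its centre and the translate of the centre by 2πi, which cannot
both be values of `L`. So Bloch's theorem applies with d = 7, and 672 = 96 · 7. -/
theorem norm_deriv_branch_le (h : IsLogarithmicRadius f R) {L : ℂ → ℂ} (hL : IsLogBranch f R L)
    {u : ℂ} (hu : Real.log R < u.re) : ‖deriv L u‖ ≤ 672 / (u.re - Real.log R) := by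
  have hsub : Metric.ball u (u.re - Real.log R) ⊆ {v | Real.log R < v.re} := by
    intro v hv
    rw [mem_ball_iff_norm] at hv
    have := (abs_le.1 ((Complex.abs_re_le_norm (v - u)))).1
    simp only [Complex.sub_re] at this
    change Real.log R < v.re
    linarith
  have := norm_deriv_le_of_not_ball_subset_image (d := 7) (sub_pos.2 hu)
    (hL.differentiableOn.mono hsub) (fun y hy => ?_)
  · norm_num at this ⊢
    exact this
  · have hpi : ‖(2 * Real.pi * Complex.I : ℂ)‖ = 2 * Real.pi := by
      simp [abs_of_pos Real.pi_pos]
    obtain ⟨a, ha, hay⟩ := hy (Metric.mem_ball_self (by norm_num))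
    obtain ⟨b, hb, hby⟩ := hy (a := y + 2 * Real.pi * Complex.I) (by
      rw [mem_ball_iff_norm, add_sub_cancel_left, hpi]
      linarith [Real.pi_lt_d2])
    have hab := h.eq_of_exp_eq hL (hsub ha) (hsub hb)
      (by rw [hay, hby, Complex.exp_add, Complex.exp_two_pi_mul_I, mul_one])
    rw [hab, hby] at hay
    simp at hay

/-- Far to the right, inverse branches of `f` in logarithmic coordinates contract by a factor `2`. -/
theorem exists_contracting_branch (h : IsLogarithmicRadius f R) {s₀ u₀ : ℂ}
    (hu₀ : Real.log R + 1364 ≤ u₀.re) (hs₀ : f (Complex.exp s₀) = Complex.exp u₀) :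
    ∃ L : ℂ → ℂ, L u₀ = s₀ ∧ ∀ u ∈ Metric.closedBall u₀ 20, f (Complex.exp (L u)) = Complex.exp u ∧
      ‖L u - s₀‖ ≤ ‖u - u₀‖ / 2 := by
  obtain ⟨L, hL, hL0⟩ := h.exists_isLogBranch (by linarith) hs₀
  -- 1364 − 20 = 1344 = 2 · 672, so the derivative is at most 1/2 on this disc.
  have hre : ∀ u ∈ Metric.closedBall u₀ 20, 1344 ≤ u.re - Real.log R := by
    intro u hu
    rw [mem_closedBall_iff_norm] at hu
    have := (abs_le.1 ((Complex.abs_re_le_norm (u - u₀)))).1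
    simp only [Complex.sub_re] at this
    linarith
  refine ⟨L, hL0, fun u hu => ⟨hL.map_exp u (by linarith [hre u hu]), ?_⟩⟩
  have := (convex_closedBall u₀ 20).norm_image_sub_le_of_norm_deriv_le (𝕜 := ℂ) (f := L)
    (C := 1 / 2) (fun v hv => hL.differentiableOn.differentiableAt
      ((isOpen_rightHalfPlane _).mem_nhds (by
        change Real.log R < v.re
        linarith [hre v hv])))
    (fun v hv => (h.norm_deriv_branch_le hL (by linarith [hre v hv])).trans (by
      have := hre v hv
      rw [div_le_iff₀ (by linarith)]
      linarith)) (Metric.mem_closedBall_self (by norm_num)) hu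
  rw [hL0] at this
  linarith

/-! ### Images of branches, and circles around the origin. -/

theorem image_branch_mem_nhds (h : IsLogarithmicRadius f R) {L : ℂ → ℂ} (hL : IsLogBranch f R L)
    {u : ℂ} (hu : Real.log R < u.re) : L '' {v | Real.log R < v.re} ∈ 𝓝 (L u) := by
  have hnb : {v : ℂ | Real.log R < v.re} ∈ 𝓝 u := (isOpen_rightHalfPlane _).mem_nhds hu
  have ha : AnalyticAt ℂ L u := hL.differentiableOn.analyticAt hnb
  rcases ha.eventually_constant_or_nhds_le_map_nhds with hc | hle
  · exfalso
    have h1 : ∀ᶠ v in 𝓝[≠] u, L v = L u ∧ Real.log R < v.re ∧ v ≠ u := by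
      filter_upwards [nhdsWithin_le_nhds hc, nhdsWithin_le_nhds hnb, self_mem_nhdsWithin]
        with v h1 h2 h3 using ⟨h1, h2, h3⟩
    obtain ⟨v, hv1, hv2, hv3⟩ := h1.exists
    exact hv3 (h.eq_of_exp_eq hL hv2 hu (by rw [hv1]))
  · exact hle (image_mem_map hnb)

/-- By symmetry, images of branches that meet coincide: the two branches differ by a translation of
the variable by a multiple of 2πi. -/
theorem image_branch_subset (h : IsLogarithmicRadius f R) {L₁ L₂ : ℂ → ℂ}
    (hL₁ : IsLogBranch f R L₁) (hL₂ : IsLogBranch f R L₂) {a b : ℂ}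
    (ha : Real.log R < a.re) (hb : Real.log R < b.re) (hab : L₁ a = L₂ b) :
    L₂ '' {v | Real.log R < v.re} ⊆ L₁ '' {v | Real.log R < v.re} := by
  obtain ⟨n, hn, hper⟩ := h.eqOn_translate_of_eq
    (G₁ := fun u => Complex.exp (L₁ u)) (G₂ := fun u => Complex.exp (L₂ u))
    hL₁.differentiableOn.cexp.continuousOn hL₂.differentiableOn.cexp.continuousOn hL₁.map_exp
    hL₂.map_exp ha hb (by rw [hab])
  have hre : ∀ u : ℂ, (u + n * (2 * Real.pi * Complex.I)).re = u.re := fun u => by simp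
  have hmaps : MapsTo (fun u : ℂ => u + n * (2 * Real.pi * Complex.I)) {v | Real.log R < v.re}
      {v | Real.log R < v.re} := fun u hu => by
    change Real.log R < _
    rw [hre]; exact hu
  have hloc : IsLocallyInjective Complex.exp := by
    have h1 := Complex.isCoveringMap_exp.isLocalHomeomorph.isLocallyInjective
    exact h1.comp_left Subtype.val_injective
  have heq := (T2Space.isSeparatedMap Complex.exp).eqOn_of_comp_eqOn hloc
    (convex_halfSpace_re_gt (Real.log R)).isPreconnected
    (g₁ := fun u => L₁ (u + n * (2 * Real.pi * Complex.I))) (g₂ := L₂)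
    (hL₁.differentiableOn.continuousOn.comp (by fun_prop) hmaps) hL₂.differentiableOn.continuousOn
    (fun u hu => hper u hu) hb (by rw [← hn, hab])
  rintro _ ⟨u, hu, rfl⟩
  exact ⟨_, hmaps hu, heq hu⟩

/-- No circle around the origin is mapped by `f` into the complement of the disc of radius `R`. -/
theorem exists_norm_eq_norm_le (h : IsLogarithmicRadius f R) {r : ℝ} (hr : 0 < r) :
    ∃ z, ‖z‖ = r ∧ ‖f z‖ ≤ R := by
  by_contra! hcon
  set s : ℝ → ℂ := fun t => Real.log r + t * Complex.I with hs
  have hscont : Continuous s := by fun_prop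
  have hbranch : ∀ t, ∃ L u, IsLogBranch f R L ∧ Real.log R < u.re ∧ L u = s t := by
    intro t
    have hn : ‖Complex.exp (s t)‖ = r := by
      rw [Complex.norm_exp]; simp [hs, Real.exp_log hr]
    have hR := hcon _ hn
    have hne : f (Complex.exp (s t)) ≠ 0 := norm_pos_iff.1 (h.pos.trans hR)
    have hu : Real.log R < (Complex.log (f (Complex.exp (s t)))).re := by
      rw [← h.lt_norm_exp_iff, Complex.exp_log hne]; exact hR
    obtain ⟨L, hL, hL0⟩ := h.exists_isLogBranch hu (Complex.exp_log hne).symm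
    exact ⟨L, _, hL, hu, hL0⟩
  obtain ⟨L, u, hL, hu, hLu⟩ := hbranch 0
  -- The vertical line over the circle is connected and covered by open images of branches, which
  -- are equal or disjoint. It therefore lies in a single image, although s(0) and s(2π) differ by
  -- 2πi.
  set A : Set ℝ := {t | s t ∈ L '' {v | Real.log R < v.re}} with hA
  have hloc : ∀ t, ∃ N ∈ 𝓝 t, (N ∩ A).Nonempty → N ⊆ A := by
    intro t
    obtain ⟨L', u', hL', hu', hLu'⟩ := hbranch t
    refine ⟨s ⁻¹' (L' '' {v | Real.log R < v.re}), hscont.continuousAt.preimage_mem_nhds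
      (by rw [← hLu']; exact h.image_branch_mem_nhds hL' hu'), ?_⟩
    rintro ⟨t', ⟨a, ha, hat⟩, ⟨b, hb, hbt⟩⟩ t'' ht''
    exact h.image_branch_subset hL hL' hb ha (hbt.trans hat.symm) ht''
  have hopen : IsOpen A := by
    rw [isOpen_iff_mem_nhds]
    intro t ht
    obtain ⟨N, hN, hNA⟩ := hloc t
    exact mem_of_superset hN (hNA ⟨t, mem_of_mem_nhds hN, ht⟩)
  have hclosed : IsClosed A := by
    rw [← isOpen_compl_iff, isOpen_iff_mem_nhds]
    intro t ht
    obtain ⟨N, hN, hNA⟩ := hloc t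
    refine mem_of_superset hN fun t' ht' htA => ht (hNA ⟨t', ht', htA⟩ (mem_of_mem_nhds hN))
  have huniv : A = univ := IsClopen.eq_univ ⟨hclosed, hopen⟩ ⟨0, u, hu, hLu⟩
  obtain ⟨a, ha, hat⟩ : (0 : ℝ) ∈ A := huniv ▸ mem_univ _
  obtain ⟨b, hb, hbt⟩ : (2 * Real.pi) ∈ A := huniv ▸ mem_univ _
  have hab : a = b := by
    refine h.eq_of_exp_eq hL ha hb ?_
    rw [hat, hbt]
    simp [hs, Complex.exp_add, Complex.exp_two_pi_mul_I]
  rw [← hab, hat] at hbt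
  simp [hs] at hbt

end IsLogarithmicRadius

/-! ### The spherical metric and growth estimates. -/

theorem exists_le_sphericalDist {M : ℝ} (hM : 0 ≤ M) :
    ∃ ε > 0, ∀ z w : ℂ, ‖w‖ ≤ M → 2 * M + 1 ≤ ‖z‖ → ε ≤ sphericalDist w z := by
  have hq : 0 < 1 / (2 * (1 + M)) := by positivity
  refine ⟨2 * Real.arcsin (1 / (2 * (1 + M))), by
    have := Real.arcsin_pos.2 hq; linarith, fun z w hw hz => ?_⟩
  rw [sphericalDist]
  have hsqrt : ∀ a : ℝ, 0 ≤ a → √(1 + a ^ 2) ≤ 1 + a := fun a ha =>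
    Real.sqrt_le_iff.2 ⟨by linarith, by nlinarith⟩
  have h1 : √(1 + ‖w‖ ^ 2) ≤ 1 + M := (hsqrt _ (norm_nonneg w)).trans (by linarith)
  have h2 : √(1 + ‖z‖ ^ 2) ≤ 1 + ‖z‖ := hsqrt _ (norm_nonneg z)
  have h3 : ‖z‖ - M ≤ ‖w - z‖ := by
    rw [norm_sub_rev]
    have := norm_sub_norm_le z w
    linarith
  -- ‖z‖ ≥ 2M + 1 is exactly the condition 2(‖z‖ − M) ≥ 1 + ‖z‖.
  have h4 : 1 / (2 * (1 + M)) ≤ ‖w - z‖ / (√(1 + ‖w‖ ^ 2) * √(1 + ‖z‖ ^ 2)) := by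
    rw [div_le_div_iff₀ (by positivity) (by positivity)]
    have h5 : √(1 + ‖w‖ ^ 2) * √(1 + ‖z‖ ^ 2) ≤ (1 + M) * (1 + ‖z‖) := by gcongr
    nlinarith
  have := Real.monotone_arcsin h4
  linarith

theorem exists_sphericalDist_lt {ε : ℝ} (hε : 0 < ε) :
    ∃ η > 0, ∀ z w : ℂ, ‖z - w‖ / (√(1 + ‖z‖ ^ 2) * √(1 + ‖w‖ ^ 2)) < η →
      sphericalDist z w < ε := by
  have hc : ContinuousAt (fun x : ℝ => 2 * Real.arcsin x) 0 := by
    have := Real.continuous_arcsin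
    fun_prop
  obtain ⟨η, hη, h⟩ := Metric.continuousAt_iff.1 hc ε hε
  refine ⟨η, hη, fun z w hzw => ?_⟩
  have hnn : 0 ≤ ‖z - w‖ / (√(1 + ‖z‖ ^ 2) * √(1 + ‖w‖ ^ 2)) := by positivity
  have := h (x := ‖z - w‖ / (√(1 + ‖z‖ ^ 2) * √(1 + ‖w‖ ^ 2)))
    (by rwa [Real.dist_eq, sub_zero, abs_of_nonneg hnn])
  rw [Real.dist_eq, Real.arcsin_zero, mul_zero, sub_zero] at this
  exact (le_abs_self _).trans_lt this

theorem norm_log_sub_log_le {z w : ℂ} (h : ‖z‖ = ‖w‖) :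
    ‖Complex.log z - Complex.log w‖ ≤ 7 := by
  refine (Complex.norm_le_abs_re_add_abs_im _).trans ?_
  have hz := Complex.abs_arg_le_pi z
  have hw := Complex.abs_arg_le_pi w
  have := abs_sub (Complex.arg z) (Complex.arg w)
  simp only [Complex.sub_re, Complex.sub_im, Complex.log_re, Complex.log_im, h, sub_self, abs_zero]
  linarith [Real.pi_lt_d2]

theorem isOpenMap_of_isTranscendentalEntire {f : ℂ → ℂ} (hf : IsTranscendentalEntire f) :
    IsOpenMap f := by
  rcases AnalyticOnNhd.is_constant_or_isOpenMap (g := f)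
    (fun x _ => hf.entire.analyticAt x) with ⟨w, hw⟩ | h
  · exact absurd ⟨Polynomial.C w, fun z => by simpa using hw z⟩ hf.not_polynomial
  · exact h

theorem isOpenMap_iterate {X : Type*} [TopologicalSpace X] {f : X → X} (hf : IsOpenMap f) (n : ℕ) :
    IsOpenMap f^[n] := by
  induction n with
  | zero => exact IsOpenMap.id
  | succ n ih => exact ih.comp hf

theorem IsTranscendentalEntire.exists_le_norm {f : ℂ → ℂ} (hf : IsTranscendentalEntire f) (K : ℝ) :
    ∀ᶠ r : ℝ in atTop, ∃ z, ‖z‖ = r ∧ K * r ≤ ‖f z‖ := by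
  by_contra hcon
  rw [not_eventually] at hcon
  refine hf.not_polynomial (exists_polynomial_of_frequently_norm_le hf.entire 1 K ?_)
  refine hcon.mono fun r hr z hz => ?_
  push Not at hr
  rw [pow_one]
  exact (hr z hz).le

/-! ### Escaping points lie outside the Fatou set. -/

namespace IsLogarithmicRadius

variable {f : ℂ → ℂ} {R : ℝ}

/-- Each pull-back along the orbit by a contracting branch halves the distance to the orbit. -/
theorem exists_preimage_of_orbit (h : IsLogarithmicRadius f R) {u : ℕ → ℂ}
    (hre : ∀ n, Real.log R + 1364 ≤ (u n).re)
    (hu : ∀ n, f (Complex.exp (u n)) = Complex.exp (u (n + 1))) (n : ℕ) :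
    ∀ v ∈ Metric.closedBall (u n) 20, ∃ s, ‖s - u 0‖ ≤ 20 / 2 ^ n ∧
      f^[n] (Complex.exp s) = Complex.exp v := by
  suffices ∀ v ∈ Metric.closedBall (u n) 20, ∃ s, ‖s - u 0‖ ≤ ‖v - u n‖ / 2 ^ n ∧
      f^[n] (Complex.exp s) = Complex.exp v by
    intro v hv
    obtain ⟨s, hs, hs'⟩ := this v hv
    refine ⟨s, hs.trans ?_, hs'⟩
    gcongr
    exact mem_closedBall_iff_norm.1 hv
  induction n with
  | zero => exact fun v _ => ⟨v, by simp, rfl⟩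
  | succ n ih =>
    intro v hv
    obtain ⟨L, -, hL⟩ := h.exists_contracting_branch (hre (n + 1)) (hu n)
    obtain ⟨h1, h2⟩ := hL v hv
    have hv' := mem_closedBall_iff_norm.1 hv
    obtain ⟨s, hs, hs'⟩ := ih (L v)
      (mem_closedBall_iff_norm.2 (by linarith [norm_nonneg (v - u (n + 1))]))
    refine ⟨s, hs.trans ?_, by rw [Function.iterate_succ_apply', hs', h1]⟩
    calc ‖L v - u n‖ / 2 ^ n ≤ (‖v - u (n + 1)‖ / 2) / 2 ^ n := by gcongr
      _ = _ := by rw [pow_succ]; field_simp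

theorem fatouSet_inter_escapingSet (h : IsLogarithmicRadius f R) :
    fatouSet f ∩ escapingSet f = ∅ := by
  rw [eq_empty_iff_forall_notMem]
  rintro z₀ ⟨⟨U, -, hzU, hU⟩, hesc⟩
  obtain ⟨ε, hε, hdist⟩ := exists_le_sphericalDist h.pos.le
  obtain ⟨δ, hδ, heq⟩ := hU z₀ hzU ε hε
  have hesc' : Tendsto (fun n => ‖f^[n] z₀‖) atTop atTop := hesc
  obtain ⟨N, hN⟩ := eventually_atTop.1 ((hesc'.eventually_ge_atTop (2 * R + 1)).and
    (hesc'.eventually_ge_atTop (Real.exp (Real.log R + 1364))))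
  -- `ε` separates the disc of radius R from all points of modulus at least 2R + 1, so nearby orbits
  -- cannot enter that disc once the orbit of z₀ is this large.
  have hbig : ∀ n ≥ N, ∀ w ∈ Metric.ball z₀ δ, R < ‖f^[n] w‖ := by
    intro n hn w hw
    by_contra hcon
    have h1 := hdist (f^[n] z₀) (f^[n] w) (not_lt.1 hcon) (hN n hn).1
    exact absurd (heq w (mem_ball_iff_norm.1 hw) n) (not_lt.2 h1)
  have hne : ∀ n, f^[N + n] z₀ ≠ 0 := fun n => by
    have := (hN (N + n) (by omega)).2
    exact norm_pos_iff.1 ((Real.exp_pos _).trans_le this)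
  set u : ℕ → ℂ := fun n => Complex.log (f^[N + n] z₀) with hu
  have hexp : ∀ n, Complex.exp (u n) = f^[N + n] z₀ := fun n => Complex.exp_log (hne n)
  have hpre := h.exists_preimage_of_orbit (u := u)
    (fun n => by
      rw [hu, Complex.log_re, Real.le_log_iff_exp_le (norm_pos_iff.2 (hne n))]
      exact (hN (N + n) (by omega)).2)
    (fun n => by rw [hexp, hexp, ← Function.iterate_succ_apply' f]; rfl)
  have hopen : IsOpen (f^[N] '' Metric.ball z₀ δ) :=
    isOpenMap_iterate (isOpenMap_of_isTranscendentalEntire h.transcendental) N _ Metric.isOpen_ball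
  have hnb : Complex.exp ⁻¹' (f^[N] '' Metric.ball z₀ δ) ∈ 𝓝 (u 0) := by
    refine Complex.continuous_exp.continuousAt.preimage_mem_nhds (hopen.mem_nhds ?_)
    rw [hexp]
    exact mem_image_of_mem _ (Metric.mem_ball_self hδ)
  obtain ⟨η, hη, hball⟩ := Metric.mem_nhds_iff.1 hnb
  obtain ⟨n, hn⟩ := exists_pow_lt_of_lt_one (show 0 < η / 20 by positivity)
    (show (1 / 2 : ℝ) < 1 by norm_num)
  -- This z has the modulus of f^[N + n] z₀, so their principal logarithms differ by at most 7 < 20;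
  -- the pull-back of z then lies in the image under `f^[N]` of the disc around z₀.
  obtain ⟨z, hz, hfz⟩ := h.exists_norm_eq_norm_le (norm_pos_iff.2 (hne n))
  have hz0 : z ≠ 0 := norm_pos_iff.1 (hz ▸ norm_pos_iff.2 (hne n))
  obtain ⟨s, hs, hsz⟩ := hpre n (Complex.log z) (mem_closedBall_iff_norm.2
    ((norm_log_sub_log_le hz).trans (by norm_num)))
  rw [Complex.exp_log hz0] at hsz
  obtain ⟨w, hw, hws⟩ := hball (mem_ball_iff_norm.2 (hs.trans_lt (by
    rw [one_div, inv_pow] at hn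
    rw [div_eq_mul_inv]
    linarith)))
  have := hbig (n + 1 + N) (by omega) w hw
  rw [Function.iterate_add_apply, hws, Function.iterate_succ_apply', hsz] at this
  exact absurd this (not_lt.2 hfz)

/-! ### Existence of escaping points by shadowing. -/

/-- Pull-back sends the disc of radius 20 around u (n + 1) into the disc of radius 10 around s n,
hence into that of radius 20 around u n. Finite shadowing follows, and compactness gives an infinite
orbit. -/
theorem exists_shadowing_orbit (h : IsLogarithmicRadius f R) {u s : ℕ → ℂ}
    (hre : ∀ n, Real.log R + 1364 ≤ (u n).re) (hsu : ∀ n, ‖s n - u n‖ ≤ 10)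
    (hu : ∀ n, f (Complex.exp (s n)) = Complex.exp (u (n + 1))) :
    ∃ z, ∀ n, f^[n] (Complex.exp z) ∈ Complex.exp '' Metric.closedBall (u n) 20 := by
  have key : ∀ n, ∀ v ∈ Metric.closedBall (u n) 20, ∃ z, f^[n] (Complex.exp z) = Complex.exp v ∧
      z ∈ Metric.closedBall (u 0) 20 ∧
      ∀ k ≤ n, f^[k] (Complex.exp z) ∈ Complex.exp '' Metric.closedBall (u k) 20 := by
    intro n
    induction n with
    | zero =>
      refine fun v hv => ⟨v, rfl, hv, fun k hk => ?_⟩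
      obtain rfl : k = 0 := by omega
      exact ⟨v, hv, rfl⟩
    | succ n ih =>
      intro v hv
      obtain ⟨L, -, hL⟩ := h.exists_contracting_branch (hre (n + 1)) (hu n)
      obtain ⟨h1, h2⟩ := hL v hv
      have hv' := mem_closedBall_iff_norm.1 hv
      obtain ⟨z, hz1, hz0, hz2⟩ := ih (L v) (mem_closedBall_iff_norm.2 (by
        have := norm_add_le (L v - s n) (s n - u n)
        rw [sub_add_sub_cancel] at this
        linarith [hsu n]))
      have hz3 : f^[n + 1] (Complex.exp z) = Complex.exp v := by
        rw [Function.iterate_succ_apply', hz1, h1]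
      refine ⟨z, hz3, hz0, fun k hk => ?_⟩
      rcases Nat.lt_or_ge k (n + 1) with hk' | hk'
      · exact hz2 k (by omega)
      · obtain rfl : k = n + 1 := by omega
        exact ⟨v, hv, hz3.symm⟩
  have hclosed : ∀ k, IsClosed ((fun z => f^[k] (Complex.exp z)) ⁻¹'
      (Complex.exp '' Metric.closedBall (u k) 20)) := fun k =>
    ((isCompact_closedBall _ _).image Complex.continuous_exp).isClosed.preimage
      ((h.transcendental.entire.continuous.iterate k).comp Complex.continuous_exp)
  set K : ℕ → Set ℂ := fun n => Metric.closedBall (u 0) 20 ∩ ⋂ k ≤ n,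
    (fun z => f^[k] (Complex.exp z)) ⁻¹' (Complex.exp '' Metric.closedBall (u k) 20) with hK
  have hKc : ∀ n, IsClosed (K n) := fun n =>
    Metric.isClosed_closedBall.inter (isClosed_iInter fun k => isClosed_iInter fun _ => hclosed k)
  obtain ⟨z, hz⟩ := IsCompact.nonempty_iInter_of_sequence_nonempty_isCompact_isClosed K
    (fun n => inter_subset_inter_right _ (biInter_mono (fun k hk => Nat.le_succ_of_le hk)
      fun _ _ => Subset.rfl))
    (fun n => by
      obtain ⟨z, -, hz0, hz⟩ := key n (u n) (Metric.mem_closedBall_self (by norm_num))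
      exact ⟨z, hz0, mem_iInter₂.2 hz⟩)
    ((isCompact_closedBall _ _).of_isClosed_subset (hKc 0) inter_subset_left) hKc
  exact ⟨z, fun n => mem_iInter₂.1 (mem_iInter.1 hz n).2 n le_rfl⟩

theorem escapingSet_nonempty (h : IsLogarithmicRadius f R) : (escapingSet f).Nonempty := by
  obtain ⟨r₀, hr₀⟩ := eventually_atTop.1 (h.transcendental.exists_le_norm 2)
  set r₁ := max r₀ (Real.exp (Real.log R + 1364)) with hr₁
  have hr₁0 : 0 < r₁ := (Real.exp_pos _).trans_le (le_max_right _ _)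
  choose! m hm1 hm2 using hr₀
  -- `m r` is a point of the circle of radius r with |f(m r)| ≥ 2r. The pseudo-orbit jumps from w n
  -- to m (ρ n) on the same circle, a logarithmic distance of at most 7, and then applies `f`.
  -- Shadowing costs at most a factor exp 20 in modulus.
  set ρ : ℕ → ℝ := fun n => (fun r => ‖f (m r)‖)^[n] r₁ with hρ
  have hsucc : ∀ n, ρ (n + 1) = ‖f (m (ρ n))‖ := fun n => Function.iterate_succ_apply' _ _ _
  have hge : ∀ n, r₁ * 2 ^ n ≤ ρ n := by
    intro n
    induction n with
    | zero => simp [hρ]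
    | succ n ih =>
      have h1 : r₁ ≤ r₁ * 2 ^ n := le_mul_of_one_le_right hr₁0.le (one_le_pow₀ (by norm_num))
      have := hm2 (ρ n) (((le_max_left _ _).trans h1).trans ih)
      rw [hsucc, pow_succ]
      linarith
  have hge1 : ∀ n, r₁ ≤ ρ n := fun n =>
    (le_mul_of_one_le_right hr₁0.le (one_le_pow₀ (by norm_num))).trans (hge n)
  have hpos : ∀ n, 0 < ρ n := fun n => hr₁0.trans_le (hge1 n)
  have hmρ : ∀ n, ‖m (ρ n)‖ = ρ n := fun n => hm1 _ ((le_max_left _ _).trans (hge1 n))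
  set w : ℕ → ℂ := fun n => n.casesOn (r₁ : ℂ) (fun k => f (m (ρ k))) with hw
  have hwn : ∀ n, ‖w n‖ = ρ n := by
    intro n
    cases n with
    | zero => simp [hw, hρ, abs_of_pos hr₁0]
    | succ n => simp [hw, hsucc]
  have hw0 : ∀ n, w n ≠ 0 := fun n => norm_pos_iff.1 (by rw [hwn]; exact hpos n)
  have hm0 : ∀ n, m (ρ n) ≠ 0 := fun n => norm_pos_iff.1 (by rw [hmρ]; exact hpos n)
  obtain ⟨z, hz⟩ := h.exists_shadowing_orbit (u := fun n => Complex.log (w n))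
    (s := fun n => Complex.log (m (ρ n)))
    (fun n => by
      rw [Complex.log_re, hwn, Real.le_log_iff_exp_le (hpos n)]
      exact (le_max_right _ _).trans (hge1 n))
    (fun n => (norm_log_sub_log_le (by rw [hwn, hmρ])).trans (by norm_num))
    (fun n => by rw [Complex.exp_log (hm0 n)]; exact (Complex.exp_log (hw0 (n + 1))).symm)
  refine ⟨Complex.exp z, ?_⟩
  have hlow : ∀ n : ℕ, r₁ * Real.exp (-20) * 2 ^ n ≤ ‖f^[n] (Complex.exp z)‖ := by
    intro n
    obtain ⟨v, hv, hvz⟩ := hz n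
    rw [← hvz, Complex.norm_exp]
    rw [mem_closedBall_iff_norm] at hv
    have h1 := (abs_le.1 ((Complex.abs_re_le_norm (v - Complex.log (w n))).trans hv)).1
    rw [Complex.sub_re, Complex.log_re, hwn] at h1
    calc r₁ * Real.exp (-20) * 2 ^ n = (r₁ * 2 ^ n) * Real.exp (-20) := by ring
      _ ≤ ρ n * Real.exp (-20) := by gcongr; exact hge n
      _ = Real.exp (Real.log (ρ n) + -20) := by rw [Real.exp_add, Real.exp_log (hpos n)]
      _ ≤ _ := Real.exp_le_exp.2 (by linarith)
  refine tendsto_atTop_mono hlow ?_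
  exact (tendsto_pow_atTop_atTop_of_one_lt (by norm_num)).const_mul_atTop
    (mul_pos hr₁0 (Real.exp_pos _))

end IsLogarithmicRadius

/-! ### The theorems of Schottky and Montel. -/

/-- The preimages of the odd integers under `cosh` form a `4`-net in the plane. -/
theorem exists_cosh_eq_odd (y : ℂ) : ∃ e : ℂ, ‖e - y‖ < 4 ∧ ∃ n : ℤ, Complex.cosh e = 2 * n + 1 := by
  obtain ⟨b, hbx, k, hk⟩ : ∃ b : ℝ, |b - y.re| < 2 ∧ ∃ k : ℕ, Real.cosh b = 2 * k + 1 := by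
    have hc : 1 ≤ Real.cosh y.re := Real.one_le_cosh _
    set k := ⌊(Real.cosh y.re - 1) / 2⌋₊ with hk
    have h1 : (k : ℝ) ≤ (Real.cosh y.re - 1) / 2 := Nat.floor_le (by linarith)
    have h2 : (Real.cosh y.re - 1) / 2 < k + 1 := Nat.lt_floor_add_one _
    have hk0 : (0 : ℝ) ≤ k := k.cast_nonneg
    obtain ⟨β, hβ0, hβ⟩ : ∃ β, 0 ≤ β ∧ Real.cosh β = 2 * k + 1 :=
      ⟨_, Real.arcosh_nonneg (by linarith), Real.cosh_arcosh (by linarith)⟩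
    have h3 : β ≤ |y.re| := by
      have : |β| ≤ |y.re| := Real.cosh_le_cosh.1 (by rw [hβ]; linarith)
      rwa [abs_of_nonneg hβ0] at this
    -- By the choice of k, cosh(Re y) < 2k + 3 ≤ 3 cosh β. A gap of 2 would give exp 2 · exp β ≤ 2
    -- cosh(Re y) < 6 exp β, but exp 2 ≥ 7.
    have h4 : |y.re| - β < 2 := by
      by_contra! hcon
      have h5 : Real.exp |y.re| ≤ 2 * Real.cosh y.re := by
        rw [← Real.cosh_abs, Real.cosh_eq]
        linarith [Real.exp_pos (-|y.re|)]
      have h6 : Real.cosh β ≤ Real.exp β := by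
        rw [Real.cosh_eq]
        have : Real.exp (-β) ≤ Real.exp β := Real.exp_le_exp.2 (by linarith)
        linarith
      have h7 : Real.exp (2 + β) ≤ Real.exp |y.re| := Real.exp_le_exp.2 (by linarith)
      have h8 : (2.7 : ℝ) ≤ Real.exp 1 := by linarith [Real.exp_one_gt_d9]
      have h9 : Real.exp 2 = Real.exp 1 * Real.exp 1 := by rw [← Real.exp_add]; norm_num
      have h10 : (7 : ℝ) ≤ Real.exp 2 := by rw [h9]; nlinarith
      rw [Real.exp_add] at h7
      have h11 : 7 * Real.exp β ≤ Real.exp 2 * Real.exp β := by gcongr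
      linarith
    rcases le_total 0 y.re with hy | hy
    · rw [abs_of_nonneg hy] at h3 h4
      exact ⟨β, by rw [abs_lt]; constructor <;> linarith, k, hβ⟩
    · rw [abs_of_nonpos hy] at h3 h4
      exact ⟨-β, by rw [abs_lt]; constructor <;> linarith, k, by rw [Real.cosh_neg, hβ]⟩
  set m := round (y.im / Real.pi) with hm
  have hmy : |m * Real.pi - y.im| ≤ 1.6 := by
    have h1 := abs_sub_round (y.im / Real.pi)
    have h2 : m * Real.pi - y.im = -((y.im / Real.pi - m) * Real.pi) := by
      field_simp [Real.pi_ne_zero]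
      ring
    rw [h2, abs_neg, abs_mul, abs_of_pos Real.pi_pos]
    calc |y.im / Real.pi - m| * Real.pi ≤ 1 / 2 * Real.pi := by gcongr
      _ ≤ 1.6 := by linarith [Real.pi_lt_d2]
  refine ⟨b + ((m * Real.pi : ℝ) : ℂ) * Complex.I, ?_, ?_⟩
  · refine (Complex.norm_le_abs_re_add_abs_im _).trans_lt ?_
    simp only [Complex.sub_re, Complex.sub_im, Complex.add_re, Complex.add_im, Complex.re_ofReal_mul,
      Complex.im_ofReal_mul, Complex.I_re, Complex.I_im, Complex.ofReal_re, Complex.ofReal_im,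
      mul_zero, mul_one, add_zero, zero_add]
    linarith
  · rw [Complex.cosh_add, Complex.cosh_mul_I, Complex.sinh_mul_I, ← Complex.ofReal_cos,
      ← Complex.ofReal_sin, Real.sin_int_mul_pi, Real.cos_int_mul_pi, ← Complex.ofReal_cosh, hk]
    rcases Int.even_or_odd m with he | ho
    · exact ⟨k, by rw [he.neg_one_zpow]; simp⟩
    · refine ⟨-k - 1, ?_⟩
      rw [ho.neg_one_zpow]
      push_cast
      ring

/-- A holomorphic function on a disc omitting `0` and `1` has the form `-exp (πi cosh g)`. -/
theorem exists_eq_neg_exp_cosh {φ : ℂ → ℂ} {c : ℂ} {r : ℝ} (hr : 0 < r)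
    (hφ : DifferentiableOn ℂ φ (Metric.ball c r))
    (h01 : ∀ z ∈ Metric.ball c r, φ z ≠ 0 ∧ φ z ≠ 1) (hl : 1 / 2 ≤ ‖φ c‖) (hu : ‖φ c‖ ≤ 2) :
    ∃ g : ℂ → ℂ, DifferentiableOn ℂ g (Metric.ball c r) ∧ ‖g c‖ ≤ 10 ∧
      ∀ z ∈ Metric.ball c r, φ z = -Complex.exp (Real.pi * Complex.I * Complex.cosh (g z)) := by
  have hconv := convex_ball c r
  have hopen : IsOpen (Metric.ball c r) := Metric.isOpen_ball
  have hc : c ∈ Metric.ball c r := Metric.mem_ball_self hr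
  have hpiI : (Real.pi * Complex.I : ℂ) ≠ 0 := by simp [Real.pi_ne_zero]
  obtain ⟨l, hld, hlc, hl'⟩ := exists_differentiableOn_log hconv hopen hφ (fun z hz => (h01 z hz).1)
    hc (Complex.exp_log (h01 c hc).1)
  -- Since φ omits 1, v omits ±1. So v² − 1 has a holomorphic square root s, and v + s = exp g with
  -- inverse v − s gives cosh g = v.
  set v : ℂ → ℂ := fun z => l z / (Real.pi * Complex.I) - 1 with hv
  have hvd : DifferentiableOn ℂ v (Metric.ball c r) := (hld.div_const _).sub_const _
  have hvφ : ∀ z ∈ Metric.ball c r, φ z = -Complex.exp (Real.pi * Complex.I * v z) := by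
    intro z hz
    have : Real.pi * Complex.I * v z = l z - Real.pi * Complex.I := by
      rw [hv]; field_simp
    rw [this, Complex.exp_sub, Complex.exp_pi_mul_I, hl' z hz, div_neg, div_one, neg_neg]
  have hw0 : ∀ z ∈ Metric.ball c r, v z ^ 2 - 1 ≠ 0 := by
    intro z hz h0
    have : v z = 1 ∨ v z = -1 := sq_eq_one_iff.1 (sub_eq_zero.1 h0)
    apply (h01 z hz).2
    rw [hvφ z hz]
    rcases this with h | h
    · rw [h, mul_one, Complex.exp_pi_mul_I, neg_neg]
    · rw [h, mul_neg_one, Complex.exp_neg, Complex.exp_pi_mul_I]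
      norm_num
  obtain ⟨q, hqd, -, hq⟩ := exists_differentiableOn_log hconv hopen
    ((hvd.pow 2).sub_const 1) hw0 hc (Complex.exp_log (hw0 c hc))
  set s : ℂ → ℂ := fun z => Complex.exp (q z / 2) with hs
  have hsd : DifferentiableOn ℂ s (Metric.ball c r) := (hqd.div_const 2).cexp
  have hs2 : ∀ z ∈ Metric.ball c r, s z ^ 2 = v z ^ 2 - 1 := by
    intro z hz
    refine Eq.trans ?_ (hq z hz)
    rw [← Complex.exp_nat_mul]
    congr 1
    push_cast
    ring
  have hprod : ∀ z ∈ Metric.ball c r, (v z + s z) * (v z - s z) = 1 := fun z hz => by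
    linear_combination -hs2 z hz
  have hsum0 : ∀ z ∈ Metric.ball c r, v z + s z ≠ 0 := fun z hz =>
    left_ne_zero_of_mul_eq_one (hprod z hz)
  obtain ⟨g, hgd, hgc, hg⟩ := exists_differentiableOn_log hconv hopen (hvd.add hsd) hsum0
    hc (Complex.exp_log (hsum0 c hc))
  refine ⟨g, hgd, ?_, fun z hz => ?_⟩
  · have hl3 : ‖l c‖ ≤ 2 * Real.pi := by
      rw [hlc]
      refine (Complex.norm_le_abs_re_add_abs_im _).trans ?_
      have h1 := Complex.abs_arg_le_pi (φ c)
      have h2 : |Real.log ‖φ c‖| ≤ 3 := by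
        have h3 := Real.log_le_sub_one_of_pos (show 0 < ‖φ c‖ by linarith)
        have h4 := Real.one_sub_inv_le_log_of_pos (show 0 < ‖φ c‖ by linarith)
        have h5 : ‖φ c‖⁻¹ ≤ 2 := by
          rw [inv_le_comm₀ (by linarith) (by norm_num)]; linarith
        rw [abs_le]
        constructor <;> linarith
      rw [Complex.log_re, Complex.log_im]
      linarith [Real.pi_gt_three]
    have hv3 : ‖v c‖ ≤ 3 := by
      refine (norm_sub_le _ _).trans ?_
      rw [norm_div, norm_mul, Complex.norm_I, mul_one, norm_one, Complex.norm_real,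
        Real.norm_of_nonneg Real.pi_pos.le]
      have : ‖l c‖ / Real.pi ≤ 2 := by rwa [div_le_iff₀ Real.pi_pos]
      linarith
    have hs4 : ‖s c‖ ≤ 4 := by
      have h1 : ‖s c‖ ^ 2 ≤ 10 := by
        rw [← norm_pow, hs2 c hc]
        refine (norm_sub_le _ _).trans ?_
        rw [norm_pow, norm_one]
        nlinarith [norm_nonneg (v c)]
      nlinarith [norm_nonneg (s c)]
    have hp7 : ‖v c + s c‖ ≤ 7 := (norm_add_le _ _).trans (by linarith)
    have hm7 : ‖v c - s c‖ ≤ 7 := (norm_sub_le _ _).trans (by linarith)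
    have hp0 : 0 < ‖v c + s c‖ := norm_pos_iff.2 (hsum0 c hc)
    have hinv : ‖v c + s c‖⁻¹ ≤ 7 := by
      have h1 := congrArg norm (hprod c hc)
      rw [norm_mul, norm_one] at h1
      rw [inv_le_iff_one_le_mul₀ hp0, ← h1, mul_comm]
      gcongr
    rw [hgc]
    refine (Complex.norm_le_abs_re_add_abs_im _).trans ?_
    have h1 := Complex.abs_arg_le_pi (v c + s c)
    have h2 : |Real.log ‖v c + s c‖| ≤ 6 := by
      have h3 := Real.log_le_sub_one_of_pos hp0
      have h4 := Real.one_sub_inv_le_log_of_pos hp0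
      rw [abs_le]
      constructor <;> linarith
    rw [Complex.log_re, Complex.log_im]
    have := Real.pi_lt_d2
    change |Real.log ‖v c + s c‖| + |(v c + s c).arg| ≤ 10
    linarith
  · have hgz : Complex.exp (g z) = v z + s z := hg z hz
    have hgn : Complex.exp (-g z) = v z - s z := by
      rw [Complex.exp_neg, hgz]
      exact inv_eq_of_mul_eq_one_right (hprod z hz)
    have : Complex.cosh (g z) = v z := by
      rw [Complex.cosh, hgz, hgn]; ring
    rw [this, hvφ z hz]

theorem norm_cosh_le_exp_norm (z : ℂ) : ‖Complex.cosh z‖ ≤ Real.exp ‖z‖ := by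
  rw [Complex.cosh, norm_div]
  have h1 := Complex.norm_exp_le_exp_norm z
  have h2 := Complex.norm_exp_le_exp_norm (-z)
  rw [norm_neg] at h2
  have h3 := norm_add_le (Complex.exp z) (Complex.exp (-z))
  rw [div_le_iff₀ (by norm_num)]
  norm_num
  linarith

/-- If cosh g took an odd value, φ would take the value 1. So g omits a 4-net and its image contains
no disc of radius 4. Bloch's theorem bounds g', so g moves by at most 96 · 4 = 384 from a centre
value of modulus at most 10. -/
theorem exists_bound_of_omits_zero_one_aux : ∃ K > 0, ∀ (φ : ℂ → ℂ) (c : ℂ) (r : ℝ), 0 < r →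
    DifferentiableOn ℂ φ (Metric.ball c r) → (∀ z ∈ Metric.ball c r, φ z ≠ 0 ∧ φ z ≠ 1) →
    1 / 2 ≤ ‖φ c‖ → ‖φ c‖ ≤ 2 → ∀ z ∈ Metric.ball c (r / 2), ‖φ z‖ ≤ K := by
  refine ⟨Real.exp (Real.pi * Real.exp 400), Real.exp_pos _, ?_⟩
  intro φ c r hr hφ h01 hl hu z hz
  obtain ⟨g, hgd, hgc, hg⟩ := exists_eq_neg_exp_cosh hr hφ h01 hl hu
  have hsub : ∀ w ∈ Metric.ball c (r / 2), Metric.ball w (r / 2) ⊆ Metric.ball c r := by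
    intro w hw
    refine Metric.ball_subset_ball' ?_
    linarith [Metric.mem_ball.1 hw]
  have hno : ∀ w ∈ Metric.ball c (r / 2), ∀ y, ¬ Metric.ball y 4 ⊆ g '' Metric.ball w (r / 2) := by
    intro w hw y hy
    obtain ⟨e, hey, n, hn⟩ := exists_cosh_eq_odd y
    obtain ⟨x, hx, hxe⟩ := hy (mem_ball_iff_norm.2 hey)
    have hx' := hsub w hw hx
    apply (h01 x hx').2
    have : (Real.pi * Complex.I * (2 * n + 1) : ℂ) =
        n * (2 * Real.pi * Complex.I) + Real.pi * Complex.I := by ring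
    rw [hg x hx', hxe, hn, this, Complex.exp_add, Complex.exp_int_mul_two_pi_mul_I,
      Complex.exp_pi_mul_I]
    norm_num
  have hr2 : 0 < r / 2 := by linarith
  have hderiv : ∀ w ∈ Metric.ball c (r / 2), ‖deriv g w‖ ≤ 96 * 4 / (r / 2) := fun w hw =>
    norm_deriv_le_of_not_ball_subset_image hr2 (hgd.mono (hsub w hw)) (hno w hw)
  have hmv := (convex_ball c (r / 2)).norm_image_sub_le_of_norm_deriv_le (𝕜 := ℂ) (f := g)
    (fun w hw => hgd.differentiableAt (Metric.isOpen_ball.mem_nhds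
      (hsub w hw (Metric.mem_ball_self hr2)))) hderiv (Metric.mem_ball_self hr2) hz
  have hzc := mem_ball_iff_norm.1 hz
  have hgz : ‖g z‖ ≤ 400 := by
    have h1 : 96 * 4 / (r / 2) * ‖z - c‖ ≤ 96 * 4 / (r / 2) * (r / 2) := by gcongr
    rw [div_mul_cancel₀ _ hr2.ne'] at h1
    have h2 := norm_sub_norm_le (g z) (g c)
    linarith
  rw [hg z (hsub z hz (Metric.mem_ball_self hr2)), norm_neg]
  refine (Complex.norm_exp_le_exp_norm _).trans (Real.exp_le_exp.2 ?_)
  rw [norm_mul, norm_mul, Complex.norm_I, mul_one, Complex.norm_real,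
    Real.norm_of_nonneg Real.pi_pos.le]
  gcongr
  exact (norm_cosh_le_exp_norm _).trans (Real.exp_le_exp.2 hgz)

/-- A weak form of Schottky's theorem. -/
theorem exists_bound_of_omits_zero_one : ∃ K > 0, ∀ (φ : ℂ → ℂ) (c : ℂ) (r : ℝ), 0 < r →
    DifferentiableOn ℂ φ (Metric.ball c r) → (∀ z ∈ Metric.ball c r, φ z ≠ 0 ∧ φ z ≠ 1) →
    ‖φ c‖ ≤ 2 → ∀ z ∈ Metric.ball c (r / 2), ‖φ z‖ ≤ K := by
  obtain ⟨K, hK, h⟩ := exists_bound_of_omits_zero_one_aux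
  refine ⟨K + 1, by linarith, fun φ c r hr hφ h01 hu z hz => ?_⟩
  by_cases hl : 1 / 2 ≤ ‖φ c‖
  · linarith [h φ c r hr hφ h01 hl hu z hz]
  -- When φ(c) is small, pass to 1 − φ, which also omits 0 and 1 and has modulus between 1/2 and 3/2
  -- at c.
  · push Not at hl
    have h1 := norm_sub_norm_le 1 (φ c)
    have h2 := norm_sub_le 1 (φ c)
    rw [norm_one] at h1 h2
    have h3 := h (fun z => 1 - φ z) c r hr (hφ.const_sub 1)
      (fun w hw => ⟨sub_ne_zero.2 (h01 w hw).2.symm, fun h0 => (h01 w hw).1 (by simpa using h0)⟩)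
      (by linarith) (by linarith) z hz
    have h4 := norm_sub_norm_le (φ z) 1
    rw [norm_one, norm_sub_rev] at h4
    linarith

/-- Schwarz's lemma on the half-size disc, where φ − φ(c) is at most 2K. -/
theorem exists_lipschitz_of_omits_zero_one : ∃ K > 0, ∀ (φ : ℂ → ℂ) (c : ℂ) (r : ℝ), 0 < r →
    DifferentiableOn ℂ φ (Metric.ball c r) → (∀ z ∈ Metric.ball c r, φ z ≠ 0 ∧ φ z ≠ 1) →
    ‖φ c‖ ≤ 2 → ∀ z ∈ Metric.ball c (r / 2), ‖φ z - φ c‖ ≤ K / r * ‖z - c‖ := by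
  obtain ⟨K, hK, h⟩ := exists_bound_of_omits_zero_one
  refine ⟨4 * K, by linarith, fun φ c r hr hφ h01 hu z hz => ?_⟩
  have hb := h φ c r hr hφ h01 hu
  have := Complex.dist_le_div_mul_dist_of_mapsTo_ball (f := φ) (c := c) (R₁ := r / 2)
    (R₂ := 2 * K) (hφ.mono (Metric.ball_subset_ball (by linarith))) (fun w hw => ?_) hz
  · rw [dist_eq_norm, dist_eq_norm] at this
    refine this.trans_eq ?_
    field_simp
    ring
  · rw [mem_closedBall_iff_norm]
    have h1 := hb w hw
    have h2 := hb c (Metric.mem_ball_self (by linarith))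
    exact (norm_sub_le _ _).trans (by linarith)

/-- **Montel's theorem**: the holomorphic functions on a disc that omit two given values are
equicontinuous, for the spherical metric, at the centre. -/
theorem exists_delta_of_omits {a b : ℂ} (hab : a ≠ b) {c : ℂ} {r ε : ℝ} (hr : 0 < r) (hε : 0 < ε) :
    ∃ δ > 0, ∀ F : ℂ → ℂ, DifferentiableOn ℂ F (Metric.ball c r) →
      (∀ z ∈ Metric.ball c r, F z ≠ a ∧ F z ≠ b) →
      ∀ w, ‖w - c‖ < δ → sphericalDist (F w) (F c) < ε := by
  obtain ⟨η, hη, hdist⟩ := exists_sphericalDist_lt hε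
  obtain ⟨K, hK, hlip⟩ := exists_lipschitz_of_omits_zero_one
  have hba : 0 < ‖b - a‖ := norm_pos_iff.2 (sub_ne_zero.2 hab.symm)
  have hba' : b - a ≠ 0 := norm_pos_iff.1 hba
  -- The two summands are the constants of the two cases below: |φ(c)| ≤ 2, and |φ(c)| ≥ 2, where
  -- 1/φ is used and the spherical denominators absorb the factors |φ(w)| and |φ(c)|.
  set D := ‖b - a‖ + (1 + ‖a‖) ^ 2 / ‖b - a‖ with hD
  have hD2 : 0 < (1 + ‖a‖) ^ 2 / ‖b - a‖ := by positivity
  have hD0 : 0 < D := by linarith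
  refine ⟨min (r / 2) (η * r / (K * D)), by positivity, fun F hF hom w hw => hdist _ _ ?_⟩
  obtain ⟨hw1, hw2⟩ := lt_min_iff.1 hw
  have hwb : w ∈ Metric.ball c (r / 2) := mem_ball_iff_norm.2 hw1
  have hc : c ∈ Metric.ball c r := Metric.mem_ball_self hr
  have hwr : w ∈ Metric.ball c r := Metric.ball_subset_ball (by linarith) hwb
  have hsmall : D * (K / r * ‖w - c‖) < η := by
    rw [lt_div_iff₀ (by positivity)] at hw2
    have : D * (K / r * ‖w - c‖) = ‖w - c‖ * (K * D) / r := by field_simp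
    rw [this, div_lt_iff₀ hr]
    exact hw2
  refine lt_of_le_of_lt ?_ hsmall
  set φ : ℂ → ℂ := fun z => (F z - a) / (b - a) with hφ
  have hφd : DifferentiableOn ℂ φ (Metric.ball c r) := (hF.sub_const a).div_const _
  have h01 : ∀ z ∈ Metric.ball c r, φ z ≠ 0 ∧ φ z ≠ 1 := fun z hz => by
    refine ⟨div_ne_zero (sub_ne_zero.2 (hom z hz).1) hba', fun h1 => (hom z hz).2 ?_⟩
    rw [hφ, div_eq_one_iff_eq hba'] at h1
    exact sub_left_injective h1
  have hFφ : F w - F c = (b - a) * (φ w - φ c) := by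
    rw [hφ]; field_simp; ring
  have hS : ∀ z : ℂ, 1 ≤ √(1 + ‖z‖ ^ 2) := fun z =>
    Real.one_le_sqrt.2 (by nlinarith [norm_nonneg z])
  rcases le_total ‖φ c‖ 2 with h2 | h2
  · have h3 := hlip φ c r hr hφd h01 h2 w hwb
    calc ‖F w - F c‖ / (√(1 + ‖F w‖ ^ 2) * √(1 + ‖F c‖ ^ 2)) ≤ ‖F w - F c‖ :=
          div_le_self (norm_nonneg _) (one_le_mul_of_one_le_of_one_le (hS _) (hS _))
      _ = ‖b - a‖ * ‖φ w - φ c‖ := by rw [hFφ, norm_mul]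
      _ ≤ D * (K / r * ‖w - c‖) := by gcongr; linarith
  · have h3 := hlip (fun z => (φ z)⁻¹) c r hr (hφd.inv fun z hz => (h01 z hz).1)
      (fun z hz => ⟨inv_ne_zero (h01 z hz).1, fun h1 => (h01 z hz).2 (inv_eq_one.1 h1)⟩)
      (by
        rw [norm_inv]
        exact (inv_le_one_of_one_le₀ (by linarith)).trans (by norm_num)) w hwb
    have hφn : ∀ z, ‖φ z‖ ≤ (1 + ‖a‖) / ‖b - a‖ * √(1 + ‖F z‖ ^ 2) := fun z => by
      rw [hφ, norm_div, div_mul_eq_mul_div]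
      gcongr
      have h4 : ‖F z‖ ≤ √(1 + ‖F z‖ ^ 2) := Real.le_sqrt_of_sq_le (by linarith)
      have h5 := norm_sub_le (F z) a
      nlinarith [hS (F z), norm_nonneg a]
    have hdiff : φ w - φ c = -((φ w)⁻¹ - (φ c)⁻¹) * (φ w * φ c) := by
      have := (h01 w hwr).1
      have := (h01 c hc).1
      field_simp
      ring
    rw [div_le_iff₀ (by have := hS (F w); have := hS (F c); positivity)]
    calc ‖F w - F c‖ = ‖b - a‖ * (‖(φ w)⁻¹ - (φ c)⁻¹‖ * (‖φ w‖ * ‖φ c‖)) := by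
          rw [hFφ, hdiff, norm_mul, norm_mul, norm_neg, norm_mul]
      _ ≤ ‖b - a‖ * ((K / r * ‖w - c‖) * (((1 + ‖a‖) / ‖b - a‖ * √(1 + ‖F w‖ ^ 2)) *
          ((1 + ‖a‖) / ‖b - a‖ * √(1 + ‖F c‖ ^ 2)))) := by
          gcongr
          · exact hφn w
          · exact hφn c
      _ = ((1 + ‖a‖) ^ 2 / ‖b - a‖) * (K / r * ‖w - c‖) *
          (√(1 + ‖F w‖ ^ 2) * √(1 + ‖F c‖ ^ 2)) := by field_simp
      _ ≤ D * (K / r * ‖w - c‖) * (√(1 + ‖F w‖ ^ 2) * √(1 + ‖F c‖ ^ 2)) := by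
          gcongr
          linarith

/-! ### The Julia set and the closure of the escaping set. -/

theorem mem_escapingSet_of_iterate_mem {f : ℂ → ℂ} {z : ℂ} (n : ℕ)
    (h : f^[n] z ∈ escapingSet f) : z ∈ escapingSet f := by
  have h1 : Tendsto (fun m : ℕ => ‖f^[m] (f^[n] z)‖) atTop atTop := h
  simp only [← Function.iterate_add_apply] at h1
  exact (tendsto_add_atTop_iff_nat (f := fun m => ‖f^[m] z‖) n).1 h1

theorem apply_mem_escapingSet {f : ℂ → ℂ} {z : ℂ} (h : z ∈ escapingSet f) :
    f z ∈ escapingSet f := by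
  have h1 : Tendsto (fun m : ℕ => ‖f^[m] z‖) atTop atTop := h
  exact (tendsto_add_atTop_iff_nat (f := fun m => ‖f^[m] z‖) 1).2 h1

theorem apply_ne_self_of_mem_escapingSet {f : ℂ → ℂ} {z : ℂ} (h : z ∈ escapingSet f) :
    f z ≠ z := by
  intro hz
  have h1 : Tendsto (fun m : ℕ => ‖f^[m] z‖) atTop atTop := h
  have h2 : (fun m : ℕ => ‖f^[m] z‖) = fun _ => ‖z‖ :=
    funext fun m => by rw [Function.iterate_fixed hz]
  rw [h2] at h1
  exact not_tendsto_const_atTop _ _ h1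

/-- If the escaping set of an entire function is nonempty, its closure contains the Julia set. -/
theorem juliaSet_subset_closure_escapingSet {f : ℂ → ℂ} (hf : Differentiable ℂ f)
    (hne : (escapingSet f).Nonempty) : juliaSet f ⊆ closure (escapingSet f) := by
  obtain ⟨p, hp⟩ := hne
  intro z hz
  by_contra hzI
  refine hz ⟨(closure (escapingSet f))ᶜ, isClosed_closure.isOpen_compl, hzI, fun u hu ε hε => ?_⟩
  obtain ⟨r, hr, hball⟩ := Metric.isOpen_iff.1 isClosed_closure.isOpen_compl u hu
  -- The omitted values are f(p) and p, distinct because a fixed point does not escape. An iterate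
  -- taking either value would start at an escaping point.
  obtain ⟨δ, hδ, h⟩ := exists_delta_of_omits (apply_ne_self_of_mem_escapingSet hp) (c := u) hr hε
  refine ⟨δ, hδ, fun w hw n => h f^[n] (hf.iterate n).differentiableOn (fun x hx => ?_) w hw⟩
  have hx' : x ∉ escapingSet f := fun hxI => hball hx (subset_closure hxI)
  exact ⟨fun hxp => hx' (mem_escapingSet_of_iterate_mem n (hxp ▸ apply_mem_escapingSet hp)),
    fun hxp => hx' (mem_escapingSet_of_iterate_mem n (hxp ▸ hp))⟩

theorem isOpen_fatouSet (f : ℂ → ℂ) : IsOpen (fatouSet f) := by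
  rw [isOpen_iff_mem_nhds]
  rintro z ⟨U, hU, hz, h⟩
  exact mem_of_superset (hU.mem_nhds hz) fun w hw => ⟨U, hU, hw, h⟩

end TranscendentalDynamics

theorem theorem5p2 (f : ℂ → ℂ) (hf : f ∈ TranscendentalDynamics.eremenkoLyubichClass) :
    TranscendentalDynamics.fatouSet f ∩ TranscendentalDynamics.escapingSet f = ∅ ∧
      TranscendentalDynamics.juliaSet f = closure (TranscendentalDynamics.escapingSet f) := by
  obtain ⟨R, hR⟩ := TranscendentalDynamics.exists_isLogarithmicRadius hf
  have hdisj := hR.fatouSet_inter_escapingSet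
  refine ⟨hdisj, Subset.antisymm (TranscendentalDynamics.juliaSet_subset_closure_escapingSet
    hf.1.entire hR.escapingSet_nonempty) (closure_minimal ?_
      (TranscendentalDynamics.isOpen_fatouSet f).isClosed_compl)⟩
  exact fun z hz hzF => (eq_empty_iff_forall_notMem.1 hdisj z) ⟨hzF, hz⟩
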